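/- \textbf{Lemma (Kernel of $H^{(n)}$).} Let $d\ge 11$ and let $p=2q+1$, $q\in\mathbb N$, be an odd integer with $p>p_{JL}:=1+\frac{4}{d-4-2\sqrt{d-1}}$. Let $Q$ be the normalized ground state, i.e. the positive, smooth, radial function on $\mathbb R^d$ with $\Delta Q+Q^p=0$ and $Q(0)=1$; write $Q=Q(r)$, $r=|y|$, and $\Lambda Q:=\frac{2}{p-1}Q+y\cdot\nabla Q$. Set $$c_\infty:=\Big[\tfrac{2}{p-1}\big(d-2-\tfrac{2}{p-1}\big)\Big]^{\frac1{p-1}},\qquad \triangle_n:=(d-2)^2-4p\,c_\infty^{p-1}+4n(d+n-2),\qquad \gamma_n:=\frac{d-2-\sqrt{\triangle_n}}{2},$$ $$\alpha:=\gamma_0-\tfrac{2}{p-1},\qquad g=g(\epsilon):=\min\big(\alpha,\sqrt{\triangle_0}\big)-\epsilon\quad(\epsilon>0),$$ $$H^{(n)}:=-\partial_{rr}-\frac{d-1}{r}\partial_r+\frac{n(d+n-2)}{r^2}-pQ^{p-1}.$$ Let $C_0,C_1>0$ be the constants for which the functions $C_0$ and $-C_1x_k$ ($1\le k\le d$) have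 norm $1$ in $L^2(\mathbb S^{d-1})$. Let $n\in\mathbb N=\{0,1,2,\dots\}$. Then there exist two smooth functions $T^{(n)}_0,\Gamma^{(n)}:(0,\infty)\to\mathbb R$ with $H^{(n)}T^{(n)}_0=H^{(n)}\Gamma^{(n)}=0$ such that: 1. every smooth $f:(0,\infty)\to\mathbb R$ with $H^{(n)}f=0$ belongs to $\mathrm{Span}(T^{(n)}_0,\Gamma^{(n)})$; 2. there are reals $(c^{(n)}_j)_{j\ge0}$ with $c^{(n)}_0\ne0$ such that, for every $l\in\mathbb N$, $T^{(n)}_0(r)=\sum_{j=0}^{l}c^{(n)}_j r^{n+2j}+O(r^{n+2+2l})$ as $r\to0$; 3. there is $C_n^\infty\neq0$ such that $T^{(n)}_0(r)\sim C^\infty_n r^{-\gamma_n}$ as $r\to+\infty$ and, for every $\epsilon>0$, $T^{(n)}_0(r)=C^\infty_n r^{-\gamma_n}+O(r^{-\gamma_n-g(\epsilon)})$ as $r\to+\infty$; 4. there are $c_n',\tilde c_n'\ne0$ such that $\Gamma^{(n)}(r)\sim c_n' r^{-(d-2+n)}$ as $r\to0$ and $\Gamma^{(n)}(r)\sim\tilde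 c_n' r^{-\gamma_n}$ as $r\to+\infty$; 5. $T^{(n)}_0>0$ on $(0,\infty)$; 6. for every spherical harmonic $Y$ of degree $n$ on $\mathbb S^{d-1}$, the function $y\mapsto T^{(n)}_0(|y|)\,Y\big(\tfrac{y}{|y|}\big)$ on $\mathbb R^d\setminus\{0\}$ extends to a $C^\infty$ function on $\mathbb R^d$; 7. for $n=0$ and $n=1$ the function $T^{(n)}_0$ is explicit: $T^{(0)}_0=\frac{1}{C_0}\Lambda Q$ and $T^{(1)}_0=-\frac1{C_1}\partial_rQ$. -/

import Mathlib

open Set Filter Topology MeasureTheory Asymptotics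
open scoped ContDiff

noncomputable section

namespace HeatKernelH

/-- The Euclidean space `ℝᵈ`. -/
abbrev Eucl (d : ℕ) : Type := EuclideanSpace ℝ (Fin d)

/-- The Joseph–Lundgren exponent in dimension `d ≥ 11` (it is `+∞` for `d ≤ 10`). -/
def pJL (d : ℕ) : ℝ := 1 + 4 / ((d : ℝ) - 4 - 2 * √((d : ℝ) - 1))

/-- `Q` is the normalized ground state: the positive smooth radial solution of
`Δ Q + Q ^ p = 0` on `ℝᵈ` with `Q 0 = 1`. -/
structure IsGroundState (d p : ℕ) (Q : Eucl d → ℝ) : Prop where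
  smooth : ContDiff ℝ ∞ Q
  radial : ∀ x y : Eucl d, ‖x‖ = ‖y‖ → Q x = Q y
  pos : ∀ x, 0 < Q x
  equation : ∀ x, Laplacian.laplacian Q x + Q x ^ p = 0
  normalized : Q 0 = 1

/-- The value at radius `r` of a radial function `F` on `ℝᵈ`, namely `F (r, 0, …, 0)`. -/
def radialProfile {d : ℕ} (F : Eucl d → ℝ) (r : ℝ) : ℝ :=
  F (WithLp.toLp 2 fun i => if (i : ℕ) = 0 then r else 0)

/-- The generator of the scaling, `Λ u = 2 / (p - 1) u + x ⬝ ∇ u`. -/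
def scalingGenerator {d : ℕ} (p : ℕ) (u : Eucl d → ℝ) (x : Eucl d) : ℝ :=
  2 / ((p : ℝ) - 1) * u x + fderiv ℝ u x x

/-- `c_∞ = [2 / (p - 1) (d - 2 - 2 / (p - 1))] ^ (1 / (p - 1))`. -/
def cInfty (d p : ℕ) : ℝ :=
  (2 / ((p : ℝ) - 1) * ((d : ℝ) - 2 - 2 / ((p : ℝ) - 1))) ^ (1 / ((p : ℝ) - 1))

/-- `△_n = (d - 2)² - 4 p c_∞ ^ (p - 1) + 4 n (d + n - 2)`. -/
def discr (d p n : ℕ) : ℝ :=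
  ((d : ℝ) - 2) ^ 2 - 4 * p * cInfty d p ^ (p - 1) + 4 * n * ((d : ℝ) + n - 2)

/-- `γ_n = (d - 2 - √△_n) / 2`. -/
def gammaExp (d p n : ℕ) : ℝ := ((d : ℝ) - 2 - √(discr d p n)) / 2

/-- `α = γ_0 - 2 / (p - 1)`. -/
def alphaExp (d p : ℕ) : ℝ := gammaExp d p 0 - 2 / ((p : ℝ) - 1)

/-- `g = min (α, √△_0) - ε`. -/
def gExp (d p : ℕ) (ε : ℝ) : ℝ := min (alphaExp d p) √(discr d p 0) - ε

/-- The operator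
`H⁽ⁿ⁾ = - ∂_rr - (d - 1) / r ∂_r + n (d + n - 2) / r² - p Q ^ (p - 1)`,
applied to `f` at the radius `r`. -/
def radialH (d p : ℕ) (Q : Eucl d → ℝ) (n : ℕ) (f : ℝ → ℝ) (r : ℝ) : ℝ :=
  -deriv (deriv f) r - ((d : ℝ) - 1) / r * deriv f r
    + n * ((d : ℝ) + n - 2) / r ^ 2 * f r - p * radialProfile Q r ^ (p - 1) * f r

/-- `f : (0, ∞) → ℝ` is smooth and `H⁽ⁿ⁾ f = 0` on `(0, ∞)`. -/
def InKernel (d p : ℕ) (Q : Eucl d → ℝ) (n : ℕ) (f : ℝ → ℝ) : Prop :=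
  ContDiffOn ℝ ∞ f (Ioi 0) ∧ ∀ r : ℝ, 0 < r → radialH d p Q n f r = 0

/-- `P` is a homogeneous harmonic polynomial of degree `n`; the spherical harmonics of degree
`n` are exactly the restrictions of such polynomials to the unit sphere. -/
def IsSolidHarmonic {d : ℕ} (n : ℕ) (P : MvPolynomial (Fin d) ℝ) : Prop :=
  P.IsHomogeneous n ∧ ∑ i, MvPolynomial.pderiv i (MvPolynomial.pderiv i P) = 0

/-- The function `Y` on the unit sphere of `ℝᵈ` is a spherical harmonic of degree `n`. -/
def IsSphericalHarmonic {d : ℕ} (n : ℕ) (Y : Metric.sphere (0 : Eucl d) 1 → ℝ) : Prop :=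
  ∃ P : MvPolynomial (Fin d) ℝ, IsSolidHarmonic n P ∧
    ∀ θ, Y θ = MvPolynomial.eval (fun i => (θ : Eucl d) i) P

/-- The surface measure of the unit sphere of `ℝᵈ`. -/
abbrev sphereMeasure (d : ℕ) : Measure (Metric.sphere (0 : Eucl d) 1) :=
  (volume : Measure (Eucl d)).toSphere

end HeatKernelH

end

/-!
The solution `T` of `H⁽ⁿ⁾ T = 0` which is regular at the origin is sought in the form `r ^ n φ (r)`
with `φ` smooth and even (`IsRegularFactor`). For `n = 0` and `n = 1` such a solution comes from the
scaling and the translation invariance of `Δ Q + Q ^ p = 0`; in general it is the sum of a Picard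
series (`exists_regular_solution`). Evenness of `φ` gives the expansion at the origin, and it makes
`φ (|y|)` smooth on `ℝᵈ` (`contDiff_even_norm`), so that `T (|y|) Y (y / |y|)` is the product of
`φ (|y|)` and a homogeneous polynomial.

The behaviour at infinity rests on the profile `v (s) = r ^ (2 / (p - 1)) Q (r)`, `r = e ^ s`, which
solves the autonomous equation `v'' + a v' - c_∞ ^ (p - 1) v + v ^ p = 0` and leaves `0` at `-∞`.
Above the Joseph–Lundgren exponent the linearization at `c_∞` has two real characteristic exponents
`-α` and `-α - √△₀`. Factoring it, and using that `x ↦ x ^ p` is convex, one sees that `z = c_∞ - v`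
satisfies `z' + α z > 0` and then `z > 0` on the whole line. Hence `v` increases to `c_∞`, and the
difference is `O (e ^ (-θ s))` for every `θ < α` (`IsEmdenFowlerOrbit.isBigO`).

Consequently the potential `p Q ^ (p - 1)` lies below the Hardy potential `p c_∞ ^ (p - 1) / r ²`,
with a controlled gap. Writing `T = r ^ (-γ_n) ψ (log r)`, the equation becomes
`ψ'' + √△_n ψ' = κ ψ` with `κ ≥ 0` and `κ = O (e ^ (-θ s))` (`IsRegularFactor.isDampedGrowth`). The
sign of `κ` makes `ψ` positive and increasing, which gives the positivity of `T` and shows that the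
limit of `ψ` at infinity is not zero; the decay of `κ` gives the existence of the limit and the rate
of convergence (`IsDampedGrowth.exists_limit`).

The second solution and the description of the kernel come from reduction of order: with
`I' = r ^ (1 - d) T ^ (-2)`, the constancy of the Wronskian shows that all solutions are
`T (a + b I)`. The primitive `I` converges at infinity, with limit `L`, and `Γ = T (L + 1 - I)`.
-/

namespace HeatKernelH

/-! ### Averaging operators and smooth even functions -/

/-- The weighted average `∫₀¹ t ^ k g (t r) dt` of `g` along the segment from `0` to `r`. For
`r ≠ 0` it equals `r ^ (-k - 1) ∫₀ʳ ρ ^ k g ρ dρ`; the present form is manifestly smooth at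
`r = 0`. -/
noncomputable def segMean (k : ℕ) (g : ℝ → ℝ) (r : ℝ) : ℝ :=
  ∫ t in (0 : ℝ)..1, t ^ k * g (t * r)

theorem pow_succ_mul_segMean (k : ℕ) (g : ℝ → ℝ) (r : ℝ) :
    r ^ (k + 1) * segMean k g r = ∫ ρ in (0 : ℝ)..r, ρ ^ k * g ρ := by
  have h := intervalIntegral.mul_integral_comp_mul_right (a := 0) (b := 1) (c := r)
    (f := fun ρ : ℝ => ρ ^ k * g ρ)
  simp only [zero_mul, one_mul] at h
  rw [← h, segMean, pow_succ', mul_assoc, ← intervalIntegral.integral_const_mul]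
  congr 1
  refine intervalIntegral.integral_congr fun t _ => ?_
  simp only [mul_pow]
  ring

theorem hasDerivAt_pow_succ_mul_segMean (k : ℕ) {g : ℝ → ℝ} (hg : Continuous g) (r : ℝ) :
    HasDerivAt (fun r => r ^ (k + 1) * segMean k g r) (r ^ k * g r) r := by
  simp only [pow_succ_mul_segMean]
  have hc : Continuous fun ρ : ℝ => ρ ^ k * g ρ := by fun_prop
  exact intervalIntegral.integral_hasDerivAt_right (hc.intervalIntegrable _ _)
    (hc.stronglyMeasurableAtFilter _ _) hc.continuousAt

theorem continuous_segMean (k : ℕ) {g : ℝ → ℝ} (hg : Continuous g) :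
    Continuous (segMean k g) := by
  refine intervalIntegral.continuous_parametric_intervalIntegral_of_continuous'
    (f := fun r t => t ^ k * g (t * r)) ?_ 0 1
  simp only [Function.uncurry_def]
  fun_prop

theorem hasDerivAt_segMean (k : ℕ) {g : ℝ → ℝ} (hg : ContDiff ℝ 1 g) (r : ℝ) :
    HasDerivAt (segMean k g) (segMean (k + 1) (deriv g) r) r := by
  have hg' : Continuous (deriv g) := hg.continuous_deriv le_rfl
  have hgc := hg.continuous
  obtain ⟨M, hM⟩ := (isCompact_closedBall (0 : ℝ) (|r| + 1)).exists_bound_of_continuousOn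
    hg'.continuousOn
  refine (intervalIntegral.hasDerivAt_integral_of_dominated_loc_of_deriv_le
    (F := fun r t => t ^ k * g (t * r)) (F' := fun r t => t ^ (k + 1) * deriv g (t * r))
    (bound := fun _ => M) (Metric.ball_mem_nhds r one_pos) ?_ ?_ ?_ ?_ ?_ ?_).2
  · exact Eventually.of_forall fun x => Continuous.aestronglyMeasurable (by fun_prop)
  · exact Continuous.intervalIntegrable (by fun_prop) _ _
  · exact Continuous.aestronglyMeasurable (by fun_prop)
  · refine Eventually.of_forall fun t ht x hx => ?_
    rw [uIoc_of_le zero_le_one] at ht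
    have hx' : |x| ≤ |r| + 1 := by
      have h1 : |x - r| < 1 := by simpa [Real.dist_eq] using hx
      have h2 := abs_sub_abs_le_abs_sub x r
      linarith
    have htx : t * x ∈ Metric.closedBall (0 : ℝ) (|r| + 1) := by
      rw [mem_closedBall_zero_iff, Real.norm_eq_abs, abs_mul, abs_of_pos ht.1]
      nlinarith [ht.2, abs_nonneg x]
    have h3 := hM _ htx
    rw [norm_mul, norm_pow, Real.norm_of_nonneg ht.1.le]
    calc t ^ (k + 1) * ‖deriv g (t * x)‖ ≤ 1 * ‖deriv g (t * x)‖ := by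
          gcongr; exact pow_le_one₀ ht.1.le ht.2
      _ ≤ M := by rwa [one_mul]
  · exact intervalIntegrable_const
  · refine Eventually.of_forall fun t _ x _ => ?_
    have h1 : HasDerivAt (fun x => t * x) t x := by simpa using (hasDerivAt_id x).const_mul t
    have h2 : HasDerivAt g (deriv g (t * x)) (t * x) :=
      (hg.differentiable one_ne_zero _).hasDerivAt
    have h3 := (h2.comp x h1).const_mul (t ^ k)
    refine h3.congr_deriv ?_
    ring

theorem contDiff_nat_segMean (n k : ℕ) {g : ℝ → ℝ} (hg : ContDiff ℝ n g) :
    ContDiff ℝ n (segMean k g) := by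
  induction n generalizing k g with
  | zero => exact contDiff_zero.2 (continuous_segMean k hg.continuous)
  | succ n ih =>
    have h1 : ContDiff ℝ 1 g := hg.of_le (by simp)
    have hd : deriv (segMean k g) = segMean (k + 1) (deriv g) :=
      funext fun r => (hasDerivAt_segMean k h1 r).deriv
    rw [Nat.cast_succ, contDiff_succ_iff_deriv] at hg ⊢
    refine ⟨fun r => (hasDerivAt_segMean k h1 r).differentiableAt, by simp, ?_⟩
    rw [hd]
    exact ih _ hg.2.2

theorem contDiff_segMean (k : ℕ) {g : ℝ → ℝ} (hg : ContDiff ℝ ∞ g) :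
    ContDiff ℝ ∞ (segMean k g) :=
  contDiff_infty.2 fun n => contDiff_nat_segMean n k (contDiff_infty.1 hg n)

theorem even_segMean (k : ℕ) {g : ℝ → ℝ} (hg : g.Even) : (segMean k g).Even := fun r => by
  simp only [segMean, mul_neg, hg _]

/-- The smooth extension of `r ↦ f' r / r`, for `f` smooth and even. -/
noncomputable def radialDeriv (f : ℝ → ℝ) : ℝ → ℝ := segMean 0 (deriv (deriv f))

theorem contDiff_deriv {f : ℝ → ℝ} (hf : ContDiff ℝ ∞ f) : ContDiff ℝ ∞ (deriv f) :=
  (contDiff_infty_iff_deriv.1 hf).2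

theorem hasDerivAt_of_contDiff {f : ℝ → ℝ} (hf : ContDiff ℝ ∞ f) (r : ℝ) :
    HasDerivAt f (deriv f r) r :=
  (hf.differentiable (by simp) r).hasDerivAt

theorem even_deriv_neg {f : ℝ → ℝ} (hf : f.Even) (r : ℝ) : deriv f (-r) = -deriv f r := by
  have h := deriv_comp_neg f r
  rw [show (fun x => f (-x)) = f from funext hf] at h
  linarith

theorem even_deriv_deriv {f : ℝ → ℝ} (hf : f.Even) : (deriv (deriv f)).Even := fun r => by
  have h := deriv_comp_neg (deriv f) r
  rw [show (fun x => deriv f (-x)) = fun x => -deriv f x from funext (even_deriv_neg hf),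
    deriv.fun_neg] at h
  linarith

theorem contDiff_radialDeriv {f : ℝ → ℝ} (hf : ContDiff ℝ ∞ f) : ContDiff ℝ ∞ (radialDeriv f) :=
  contDiff_segMean 0 (contDiff_deriv (contDiff_deriv hf))

theorem even_radialDeriv {f : ℝ → ℝ} (hf : f.Even) : (radialDeriv f).Even :=
  even_segMean 0 (even_deriv_deriv hf)

theorem deriv_eq_mul_radialDeriv {f : ℝ → ℝ} (hf : ContDiff ℝ ∞ f) (he : f.Even) (r : ℝ) :
    deriv f r = r * radialDeriv f r := by
  have h0 : deriv f 0 = 0 := by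
    have := even_deriv_neg he 0
    rw [neg_zero] at this
    linarith
  have h := pow_succ_mul_segMean 0 (deriv (deriv f)) r
  have h2 : ∫ ρ in (0 : ℝ)..r, deriv (deriv f) ρ = deriv f r - deriv f 0 :=
    intervalIntegral.integral_eq_sub_of_hasDerivAt
      (fun x _ => hasDerivAt_of_contDiff (contDiff_deriv hf) x)
      ((contDiff_deriv (contDiff_deriv hf)).continuous.intervalIntegrable _ _)
  simp only [pow_zero, one_mul, zero_add, pow_one] at h
  rw [radialDeriv, h, h2, h0, sub_zero]

/-- A smooth even function has a remainder of order two at the origin which is again smooth and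
even. -/
theorem even_eq_add_sq_mul {f : ℝ → ℝ} (hf : ContDiff ℝ ∞ f) (he : f.Even) (r : ℝ) :
    f r = f 0 + r ^ 2 * segMean 1 (radialDeriv f) r := by
  have h := pow_succ_mul_segMean 1 (radialDeriv f) r
  have h2 : ∫ ρ in (0 : ℝ)..r, ρ ^ 1 * radialDeriv f ρ = f r - f 0 := by
    refine intervalIntegral.integral_eq_sub_of_hasDerivAt (fun x _ => ?_) ?_
    · rw [pow_one, ← deriv_eq_mul_radialDeriv hf he]
      exact hasDerivAt_of_contDiff hf x
    · have := (contDiff_radialDeriv hf).continuous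
      exact Continuous.intervalIntegrable (by fun_prop) _ _
  rw [h2, one_add_one_eq_two] at h
  linarith

/-- The even Taylor expansion of a smooth even function, with its remainder. -/
theorem exists_even_expansion {f : ℝ → ℝ} (hf : ContDiff ℝ ∞ f) (he : f.Even) :
    ∃ c : ℕ → ℝ, c 0 = f 0 ∧ ∀ l : ℕ, ∃ g : ℝ → ℝ, Continuous g ∧
      ∀ r, f r = ∑ j ∈ Finset.range (l + 1), c j * r ^ (2 * j) + r ^ (2 * l + 2) * g r := by
  let S : (ℝ → ℝ) → ℝ → ℝ := fun f => segMean 1 (radialDeriv f)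
  have hS : ∀ j, ContDiff ℝ ∞ (S^[j] f) ∧ (S^[j] f).Even := by
    intro j
    induction j with
    | zero => exact ⟨hf, he⟩
    | succ j ih =>
      rw [Function.iterate_succ_apply']
      exact ⟨contDiff_segMean 1 (contDiff_radialDeriv ih.1),
        even_segMean 1 (even_radialDeriv ih.2)⟩
  refine ⟨fun j => S^[j] f 0, rfl, fun l => ⟨S^[l + 1] f, (hS _).1.continuous, fun r => ?_⟩⟩
  induction l with
  | zero => simpa using even_eq_add_sq_mul hf he r
  | succ l ih =>
    rw [Finset.sum_range_succ, ih, even_eq_add_sq_mul (hS (l + 1)).1 (hS (l + 1)).2 r,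
      Function.iterate_succ_apply' S (l + 1)]
    ring

/-! ### Radial functions -/

section Radial

variable {E : Type*} [NormedAddCommGroup E] [InnerProductSpace ℝ E]

/-- A smooth even function of the norm has gradient `(f' (‖y‖) / ‖y‖) y`, also at the origin. -/
theorem hasFDerivAt_even_norm {f : ℝ → ℝ} (hf : ContDiff ℝ ∞ f) (he : f.Even) (y : E) :
    HasFDerivAt (fun y : E => f ‖y‖) (radialDeriv f ‖y‖ • innerSL ℝ y) y := by
  rcases eq_or_ne y 0 with rfl | hy
  · rw [map_zero, smul_zero, hasFDerivAt_iff_isLittleO_nhds_zero]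
    have h1 : (fun h : E => ‖h‖ ^ 2 * segMean 1 (radialDeriv f) ‖h‖) =o[𝓝 0] fun h => h := by
      have hc : ContinuousAt (fun h : E => ‖h‖ * segMean 1 (radialDeriv f) ‖h‖) 0 := by
        have := continuous_segMean 1 (contDiff_radialDeriv hf).continuous
        fun_prop
      rw [ContinuousAt, norm_zero, zero_mul] at hc
      have h2 := ((isLittleO_one_iff ℝ).2 hc).mul_isBigO (isBigO_refl (fun h : E => ‖h‖) (𝓝 0))
      refine (h2.congr (fun h => by ring) fun h => one_mul _).norm_right.of_norm_right.of_norm_right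
    refine h1.congr_left fun h => ?_
    have := even_eq_add_sq_mul hf he ‖h‖
    simp only [zero_add, norm_zero, zero_apply, sub_zero]
    linarith
  · have hy' : ‖y‖ ≠ 0 := norm_ne_zero_iff.2 hy
    have h1 : HasFDerivAt (fun y : E => ‖y‖) ((1 / (2 * √(‖y‖ ^ 2))) • (2 • innerSL ℝ y)) y := by
      have := (hasStrictFDerivAt_norm_sq y).hasFDerivAt.sqrt (by positivity)
      refine this.congr_of_eventuallyEq (Eventually.of_forall fun z => ?_)
      simp [Real.sqrt_sq]
    refine ((hasDerivAt_of_contDiff hf ‖y‖).comp_hasFDerivAt y h1).congr_fderiv ?_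
    rw [deriv_eq_mul_radialDeriv hf he, Real.sqrt_sq (norm_nonneg y)]
    ext z
    simp
    field_simp

theorem contDiff_even_norm {f : ℝ → ℝ} (hf : ContDiff ℝ ∞ f) (he : f.Even) :
    ContDiff ℝ ∞ (fun y : E => f ‖y‖) := by
  refine contDiff_infty.2 fun n => ?_
  induction n generalizing f with
  | zero => exact contDiff_zero.2 (hf.continuous.comp continuous_norm)
  | succ n ih =>
    rw [Nat.cast_succ, contDiff_succ_iff_fderiv]
    refine ⟨fun y => (hasFDerivAt_even_norm hf he y).differentiableAt, by simp, ?_⟩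
    rw [show fderiv ℝ (fun y : E => f ‖y‖) = fun y => radialDeriv f ‖y‖ • innerSL ℝ y from
      funext fun y => (hasFDerivAt_even_norm hf he y).fderiv]
    exact (ih (contDiff_radialDeriv hf) (even_radialDeriv he)).smul (innerSL ℝ).contDiff

theorem laplacian_even_norm [FiniteDimensional ℝ E] {f : ℝ → ℝ} (hf : ContDiff ℝ ∞ f)
    (he : f.Even) (y : E) :
    Laplacian.laplacian (fun y : E => f ‖y‖) y =
      deriv (deriv f) ‖y‖ + ((Module.finrank ℝ E : ℝ) - 1) * radialDeriv f ‖y‖ := by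
  have hD := contDiff_radialDeriv hf
  have hDe := even_radialDeriv he
  rw [InnerProductSpace.laplacian_eq_iteratedFDeriv_stdOrthonormalBasis]
  simp only [iteratedFDeriv_two_apply, Matrix.cons_val_zero, Matrix.cons_val_one]
  rw [show fderiv ℝ (fun y : E => f ‖y‖) = fun y => radialDeriv f ‖y‖ • innerSL ℝ y from
      funext fun y => (hasFDerivAt_even_norm hf he y).fderiv]
  have hb := (stdOrthonormalBasis ℝ E).sum_sq_norm_inner_right y
  have h2 : deriv (deriv f) ‖y‖ =
      radialDeriv f ‖y‖ + ‖y‖ * (‖y‖ * radialDeriv (radialDeriv f) ‖y‖) := by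
    rw [show deriv f = fun r => r * radialDeriv f r from
      funext (deriv_eq_mul_radialDeriv hf he)]
    rw [((hasDerivAt_id' _).fun_mul (hasDerivAt_of_contDiff hD _)).deriv,
      deriv_eq_mul_radialDeriv hD hDe]
    ring
  rw [h2]
  have hterm : ∀ i, fderiv ℝ (fun y : E => radialDeriv f ‖y‖ • innerSL ℝ y) y
        (stdOrthonormalBasis ℝ E i) (stdOrthonormalBasis ℝ E i) =
      radialDeriv f ‖y‖ + radialDeriv (radialDeriv f) ‖y‖ *
        ‖inner ℝ (stdOrthonormalBasis ℝ E i) y‖ ^ 2 := fun i => by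
    rw [((hasFDerivAt_even_norm hD hDe y).fun_smul (innerSL ℝ (E := E)).hasFDerivAt).fderiv]
    change radialDeriv f ‖y‖ * inner ℝ (stdOrthonormalBasis ℝ E i) (stdOrthonormalBasis ℝ E i) +
      radialDeriv (radialDeriv f) ‖y‖ * inner ℝ y (stdOrthonormalBasis ℝ E i) *
        inner ℝ y (stdOrthonormalBasis ℝ E i) = _
    rw [real_inner_comm y, real_inner_self_eq_norm_sq, OrthonormalBasis.norm_eq_one,
      Real.norm_eq_abs, sq_abs]
    ring
  simp only [hterm]
  rw [Finset.sum_add_distrib, ← Finset.mul_sum, hb]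
  simp
  ring

end Radial

/-! ### The radial profile of the ground state -/

theorem radialProfile_eq {d : ℕ} (hd : 0 < d) (F : Eucl d → ℝ) (r : ℝ) :
    radialProfile F r = F (r • EuclideanSpace.single (⟨0, hd⟩ : Fin d) (1 : ℝ)) := by
  rw [radialProfile]
  congr 1
  ext i
  simp [Fin.ext_iff]

theorem contDiff_radialProfile {d : ℕ} (hd : 0 < d) {F : Eucl d → ℝ} (hF : ContDiff ℝ ∞ F) :
    ContDiff ℝ ∞ (radialProfile F) := by
  rw [show radialProfile F = fun r => F (r • EuclideanSpace.single (⟨0, hd⟩ : Fin d) (1 : ℝ)) from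
    funext (radialProfile_eq hd F)]
  fun_prop

section GroundState

variable {d p : ℕ} {Q : Eucl d → ℝ}

theorem IsGroundState.even_profile (hd : 0 < d) (hQ : IsGroundState d p Q) :
    (radialProfile Q).Even := fun r => by
  rw [radialProfile_eq hd, radialProfile_eq hd]
  exact hQ.radial _ _ (by simp [norm_smul])

theorem IsGroundState.eq_profile_norm (hd : 0 < d) (hQ : IsGroundState d p Q) (x : Eucl d) :
    Q x = radialProfile Q ‖x‖ := by
  rw [radialProfile_eq hd]
  exact hQ.radial _ _ (by simp [norm_smul])

theorem IsGroundState.profile_pos (hQ : IsGroundState d p Q) (r : ℝ) : 0 < radialProfile Q r :=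
  hQ.pos _

theorem IsGroundState.profile_zero (hd : 0 < d) (hQ : IsGroundState d p Q) :
    radialProfile Q 0 = 1 := by
  rw [radialProfile_eq hd, zero_smul, hQ.normalized]

theorem IsGroundState.profile_equation (hd : 0 < d) (hQ : IsGroundState d p Q) {r : ℝ}
    (hr : 0 ≤ r) :
    deriv (deriv (radialProfile Q)) r + ((d : ℝ) - 1) * radialDeriv (radialProfile Q) r
      + radialProfile Q r ^ p = 0 := by
  have h := hQ.equation (r • EuclideanSpace.single (⟨0, hd⟩ : Fin d) (1 : ℝ))
  rw [hQ.eq_profile_norm hd, show Q = fun y => radialProfile Q ‖y‖ from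
    funext (hQ.eq_profile_norm hd), laplacian_even_norm (contDiff_radialProfile hd hQ.smooth)
    (hQ.even_profile hd), ← show Q = fun y => radialProfile Q ‖y‖ from
    funext (hQ.eq_profile_norm hd)] at h
  simpa [norm_smul, abs_of_nonneg hr] using h

theorem IsGroundState.deriv_deriv_profile (hd : 0 < d) (hQ : IsGroundState d p Q) {r : ℝ}
    (hr : 0 < r) :
    deriv (deriv (radialProfile Q)) r =
      -(((d : ℝ) - 1) / r * deriv (radialProfile Q) r) - radialProfile Q r ^ p := by
  have h := hQ.profile_equation hd hr.le
  rw [deriv_eq_mul_radialDeriv (contDiff_radialProfile hd hQ.smooth) (hQ.even_profile hd)]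
  field_simp
  linarith

theorem IsGroundState.radialDeriv_profile_zero (hd : 0 < d) (hQ : IsGroundState d p Q) :
    radialDeriv (radialProfile Q) 0 = -(1 / (d : ℝ)) := by
  have h := hQ.profile_equation hd le_rfl
  have h2 : radialDeriv (radialProfile Q) 0 = deriv (deriv (radialProfile Q)) 0 := by
    simp [radialDeriv, segMean]
  have hd' : (0 : ℝ) < d := by exact_mod_cast hd
  rw [← h2, hQ.profile_zero hd, one_pow] at h
  field_simp
  linarith

theorem IsGroundState.profile_scalingGenerator (hd : 0 < d) (hQ : IsGroundState d p Q) (r : ℝ) :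
    radialProfile (scalingGenerator p Q) r =
      2 / ((p : ℝ) - 1) * radialProfile Q r + r * deriv (radialProfile Q) r := by
  rw [radialProfile_eq hd, scalingGenerator, ← radialProfile_eq hd Q r]
  have h1 : HasDerivAt (fun r : ℝ => r • EuclideanSpace.single (⟨0, hd⟩ : Fin d) (1 : ℝ))
      (EuclideanSpace.single (⟨0, hd⟩ : Fin d) (1 : ℝ)) r := by
    simpa using (hasDerivAt_id r).smul_const (EuclideanSpace.single (⟨0, hd⟩ : Fin d) (1 : ℝ))
  have h2 := (hQ.smooth.differentiable (by simp) _).hasFDerivAt.comp_hasDerivAt r h1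
  have h3 : radialProfile Q = Q ∘ fun r => r • EuclideanSpace.single (⟨0, hd⟩ : Fin d) (1 : ℝ) :=
    funext (radialProfile_eq hd Q)
  rw [← h3] at h2
  rw [h2.deriv, map_smul, smul_eq_mul]

end GroundState

/-! ### Monotonicity of exponentially weighted functions -/

theorem hasDerivAt_exp_mul {y : ℝ → ℝ} {y' s : ℝ} (lam : ℝ) (h : HasDerivAt y y' s) :
    HasDerivAt (fun s => Real.exp (lam * s) * y s) (Real.exp (lam * s) * (y' + lam * y s)) s := by
  have h1 : HasDerivAt (fun s => Real.exp (lam * s)) (Real.exp (lam * s) * lam) s := by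
    simpa using ((hasDerivAt_id s).const_mul lam).exp
  exact (h1.fun_mul h).congr_deriv (by ring)

theorem hasDerivAt_exp_neg_mul (lam s : ℝ) :
    HasDerivAt (fun s => Real.exp (-(lam * s))) (-(lam * Real.exp (-(lam * s)))) s := by
  have := ((hasDerivAt_id s).const_mul lam).neg.exp
  refine this.congr_deriv ?_
  simp
  ring

theorem monotone_of_hasDerivAt_nonneg {f f' : ℝ → ℝ} (h : ∀ s, HasDerivAt f (f' s) s)
    (h' : ∀ s, 0 ≤ f' s) : Monotone f :=
  monotone_of_deriv_nonneg (fun s => (h s).differentiableAt) fun s => by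
    rw [(h s).deriv]; exact h' s

theorem monotoneOn_of_hasDerivAt_nonneg {f f' : ℝ → ℝ} {D : Set ℝ} (hD : Convex ℝ D)
    (h : ∀ s ∈ D, HasDerivAt f (f' s) s) (h' : ∀ s ∈ D, 0 ≤ f' s) : MonotoneOn f D :=
  monotoneOn_of_deriv_nonneg hD (fun s hs => (h s hs).continuousAt.continuousWithinAt)
    (fun s hs => (h s (interior_subset hs)).differentiableAt.differentiableWithinAt) fun s hs => by
      rw [(h s (interior_subset hs)).deriv]; exact h' s (interior_subset hs)

theorem antitoneOn_of_hasDerivAt_nonpos {f f' : ℝ → ℝ} {D : Set ℝ} (hD : Convex ℝ D)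
    (h : ∀ s ∈ D, HasDerivAt f (f' s) s) (h' : ∀ s ∈ D, f' s ≤ 0) : AntitoneOn f D :=
  antitoneOn_of_deriv_nonpos hD (fun s hs => (h s hs).continuousAt.continuousWithinAt)
    (fun s hs => (h s (interior_subset hs)).differentiableAt.differentiableWithinAt) fun s hs => by
      rw [(h s (interior_subset hs)).deriv]; exact h' s (interior_subset hs)

/-- A solution of the differential inequality `y' + λ y ≥ 0` on the line which is positive near
`-∞` stays positive. -/
theorem pos_of_deriv_add_mul_nonneg {y y' : ℝ → ℝ} (lam : ℝ) (h : ∀ s, HasDerivAt y (y' s) s)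
    (h' : ∀ s, 0 ≤ y' s + lam * y s) (hy : ∀ᶠ s in atBot, 0 < y s) (s : ℝ) : 0 < y s := by
  have hm := monotone_of_hasDerivAt_nonneg (fun s => hasDerivAt_exp_mul lam (h s))
    fun s => mul_nonneg (Real.exp_pos _).le (h' s)
  obtain ⟨t, ht, hts⟩ := (hy.and (eventually_le_atBot s)).exists
  have h1 : 0 < Real.exp (lam * s) * y s :=
    lt_of_lt_of_le (mul_pos (Real.exp_pos _) ht) (hm hts)
  exact (mul_pos_iff_of_pos_left (Real.exp_pos _)).1 h1

/-! ### The Emden–Fowler equation -/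

section EmdenFowler

variable {v v1 : ℝ → ℝ} {a lam1 lam2 c : ℝ} {p : ℕ}

/-- The convexity of `x ↦ x ^ p`: the graph lies above its tangent at `c`. -/
theorem tangent_le_pow {x : ℝ} (hx : 0 < x) (hc : 0 < c) (hp : 1 ≤ p) :
    (p : ℝ) * c ^ (p - 1) * (x - c) + c ^ p ≤ x ^ p := by
  have h := one_add_mul_le_pow (a := x / c - 1) (by have := div_pos hx hc; linarith) p
  have h2 := mul_le_mul_of_nonneg_left h (pow_pos hc p).le
  rw [← mul_pow, add_sub_cancel, mul_div_cancel₀ _ hc.ne'] at h2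
  refine le_trans (le_of_eq ?_) h2
  obtain ⟨k, rfl⟩ := Nat.exists_eq_add_of_le' hp
  rw [Nat.add_sub_cancel, pow_succ]
  field_simp
  ring

/-- `v`, with derivative `v1`, is a positive orbit of the autonomous Emden–Fowler equation
`v'' + a v' - c ^ (p - 1) v + v ^ p = 0` which leaves the equilibrium `0` at `-∞` in the increasing
direction. The characteristic exponents `-lam1`, `-lam2` of the linearization at the equilibrium
`c` are required to be real and distinct. -/
structure IsEmdenFowlerOrbit (p : ℕ) (a c lam1 lam2 : ℝ) (v v1 : ℝ → ℝ) : Prop where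
  c_pos : 0 < c
  two_le : 2 ≤ p
  lam1_pos : 0 < lam1
  lam1_lt : lam1 < lam2
  sum_eq : lam1 + lam2 = a
  prod_eq : lam1 * lam2 = ((p : ℝ) - 1) * c ^ (p - 1)
  hasDerivAt : ∀ s, HasDerivAt v (v1 s) s
  hasDerivAt_deriv : ∀ s, HasDerivAt v1 (-(a * v1 s) + c ^ (p - 1) * v s - v s ^ p) s
  pos : ∀ s, 0 < v s
  tendsto_atBot : Tendsto v atBot (𝓝 0)
  deriv_tendsto_atBot : Tendsto v1 atBot (𝓝 0)
  eventually_deriv_pos : ∀ᶠ s in atBot, 0 < v1 s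

namespace IsEmdenFowlerOrbit

/-- An orbit of the Emden–Fowler equation emanating from `0` satisfies a one-sided first order
inequality: the linearization at the equilibrium `c` factors over the reals, and the nonlinearity
is convex. -/
theorem slope_lt (h : IsEmdenFowlerOrbit p a c lam1 lam2 v v1) (s : ℝ) :
    v1 s < lam1 * (c - v s) := by
  obtain ⟨hc, hp, hlam1, hlam, hsum, hprod, hv, hv1, hpos, hbot, hbot1, hev⟩ := h
  have hcc : c ^ (p - 1) * c = c ^ p := by rw [← pow_succ]; congr 1; omega
  have hy : ∀ s, HasDerivAt (fun s => lam1 * (c - v s) - v1 s)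
      (lam1 * (-v1 s) - (-(a * v1 s) + c ^ (p - 1) * v s - v s ^ p)) s := fun s =>
    (((hv s).const_sub c).const_mul lam1).sub (hv1 s)
  have := pos_of_deriv_add_mul_nonneg lam2 hy (fun s => ?_) ?_ s
  · linarith
  · have ht := tangent_le_pow (p := p) (hpos s) hc (by omega)
    subst hsum
    have : lam2 * (lam1 * (c - v s)) = ((p : ℝ) - 1) * c ^ (p - 1) * (c - v s) := by
      rw [← hprod]; ring
    nlinarith
  · have : Tendsto (fun s => lam1 * (c - v s) - v1 s) atBot (𝓝 (lam1 * (c - 0) - 0)) :=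
      ((hbot.const_sub c).const_mul lam1).sub hbot1
    exact this.eventually (lt_mem_nhds (by rw [sub_zero, sub_zero]; exact mul_pos hlam1 hc))

theorem lt (h : IsEmdenFowlerOrbit p a c lam1 lam2 v v1) (s : ℝ) : v s < c := by
  have hsl := h.slope_lt
  obtain ⟨hc, hp, hlam1, hlam, hsum, hprod, hv, hv1, hpos, hbot, hbot1, hev⟩ := h
  have := pos_of_deriv_add_mul_nonneg lam1 (fun s => (hv s).const_sub c) (fun s => ?_) ?_ s
  · linarith
  · linarith [hsl s]
  · have h0 : Tendsto (fun s => c - v s) atBot (𝓝 (c - 0)) := hbot.const_sub c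
    exact h0.eventually (lt_mem_nhds (by simpa using hc))

theorem deriv_pos (h : IsEmdenFowlerOrbit p a c lam1 lam2 v v1) (s : ℝ) : 0 < v1 s := by
  have hlt := h.lt
  obtain ⟨hc, hp, hlam1, hlam, hsum, hprod, hv, hv1, hpos, hbot, hbot1, hev⟩ := h
  refine pos_of_deriv_add_mul_nonneg a hv1 (fun s => ?_) hev s
  have h2 : v s ^ (p - 1) ≤ c ^ (p - 1) := pow_le_pow_left₀ (hpos s).le (hlt s).le _
  have h3 : v s ^ p = v s ^ (p - 1) * v s := by rw [← pow_succ]; congr 1; omega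
  rw [h3]
  nlinarith [mul_le_mul_of_nonneg_right h2 (hpos s).le]

theorem tendsto (h : IsEmdenFowlerOrbit p a c lam1 lam2 v v1) : Tendsto v atTop (𝓝 c) := by
  have hlt := h.lt
  have hd := h.deriv_pos
  have hsl := h.slope_lt
  obtain ⟨hc, hp, hlam1, hlam, hsum, hprod, hv, hv1, hpos, hbot, hbot1, hev⟩ := h
  have hmono : Monotone v := monotone_of_hasDerivAt_nonneg hv fun s => (hd s).le
  have hbdd : BddAbove (range v) := ⟨c, by rintro _ ⟨s, rfl⟩; exact (hlt s).le⟩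
  have hL := tendsto_atTop_ciSup hmono hbdd
  set L := ⨆ s, v s with hLdef
  have hvL : ∀ s, v s ≤ L := fun s => le_ciSup hbdd s
  have hLc : L ≤ c := ciSup_le fun s => (hlt s).le
  rcases hLc.eq_or_lt with h | h
  · rwa [h] at hL
  exfalso
  have hLpos : 0 < L := (hpos 0).trans_le (hvL 0)
  -- If the limit were below `c`, the forcing term would stay above `η > 0` and the bounded
  -- quantity `v' + a v` would grow linearly.
  set η := v 0 * (c ^ (p - 1) - L ^ (p - 1)) with hη
  have hηpos : 0 < η := mul_pos (hpos 0)
    (sub_pos.2 (pow_lt_pow_left₀ h hLpos.le (by omega)))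
  have hm : MonotoneOn (fun s => v1 s + a * v s - η * s) (Ici 0) := by
    refine monotoneOn_of_hasDerivAt_nonneg (convex_Ici 0)
      (fun s _ => ((hv1 s).add ((hv s).const_mul a)).sub ((hasDerivAt_id s).const_mul η))
      fun s hs => ?_
    have h1 : v 0 ≤ v s := hmono hs
    have h2 : v s ^ (p - 1) ≤ L ^ (p - 1) := pow_le_pow_left₀ (hpos s).le (hvL s) _
    have h3 : v s ^ p = v s ^ (p - 1) * v s := by rw [← pow_succ]; congr 1; omega
    have h4 : L ^ (p - 1) < c ^ (p - 1) := pow_lt_pow_left₀ h hLpos.le (by omega)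
    have h5 : η ≤ v s * (c ^ (p - 1) - v s ^ (p - 1)) :=
      mul_le_mul h1 (by linarith) (by linarith) (hpos s).le
    rw [h3]
    linarith
  have ha : 0 < a := by linarith
  set s := (lam1 * c + a * c) / η with hs
  have hs0 : 0 ≤ s := by positivity
  have hms := hm (self_mem_Ici) (mem_Ici.2 hs0) hs0
  have e1 : η * s = lam1 * c + a * c := by rw [hs]; field_simp
  simp only [mul_zero, sub_zero] at hms
  have e2 : lam1 * (c - v s) < lam1 * c := by nlinarith [hpos s]
  have e3 : a * v s < a * c := by nlinarith [hlt s]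
  have e4 : 0 < a * v 0 := mul_pos ha (hpos 0)
  linarith [hd 0, hsl s]

/-- The orbit approaches the equilibrium with every exponential rate below the smaller
characteristic exponent. -/
theorem isBigO (h : IsEmdenFowlerOrbit p a c lam1 lam2 v v1) {th : ℝ} (hth : th < lam1) :
    (fun s => c - v s) =O[atTop] fun s => Real.exp (-(th * s)) := by
  have hlt := h.lt
  have htop := h.tendsto
  obtain ⟨hc, hp, hlam1, hlam, hsum, hprod, hv, hv1, hpos, hbot, hbot1, hev⟩ := h
  have hcc : c ^ (p - 1) * c = c ^ p := by rw [← pow_succ]; congr 1; omega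
  obtain ⟨ε, rfl⟩ : ∃ ε, th = lam1 - ε := ⟨lam1 - th, by ring⟩
  have hε : 0 < ε := by linarith
  have ho := ((hasDerivAt_pow p c).isLittleO.comp_tendsto htop).def
    (show 0 < ε * (lam2 - lam1) from mul_pos hε (by linarith))
  obtain ⟨S, hS⟩ := eventually_atTop.1 ho
  -- Replacing the rates `lam1`, `lam2` by `lam1 - ε`, `lam2 + ε` changes the linear part by
  -- `-ε (lam2 - lam1 + ε) (c - v)`, which dominates the nonlinear part near `c`.
  have hu : ∀ s, HasDerivAt (fun s => (lam1 - ε) * (c - v s) - v1 s)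
      ((lam1 - ε) * (-v1 s) - (-(a * v1 s) + c ^ (p - 1) * v s - v s ^ p)) s := fun s =>
    (((hv s).const_sub c).const_mul _).sub (hv1 s)
  have hanti := antitoneOn_of_hasDerivAt_nonpos (convex_Ici S)
    (fun s _ => hasDerivAt_exp_mul (lam2 + ε) (hu s)) (fun s hs => by
      refine mul_nonpos_of_nonneg_of_nonpos (Real.exp_pos _).le ?_
      have h1 := hS s hs
      simp only [Function.comp_apply, smul_eq_mul, Real.norm_eq_abs] at h1
      rw [abs_sub_comm (v s) c, abs_of_pos (sub_pos.2 (hlt s))] at h1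
      have h2 := (le_abs_self _).trans h1
      subst hsum
      have h3 : lam2 * lam1 * (c - v s) = ((p : ℝ) - 1) * c ^ (p - 1) * (c - v s) := by
        rw [← hprod]; ring
      have h4 : 0 ≤ ε ^ 2 * (c - v s) := mul_nonneg (sq_nonneg _) (sub_pos.2 (hlt s)).le
      nlinarith)
  set C := |Real.exp ((lam2 + ε) * S) * ((lam1 - ε) * (c - v S) - v1 S)| with hC
  set k := lam2 - lam1 + 2 * ε with hk
  have hkpos : 0 < k := by linarith
  have hanti2 := antitoneOn_of_hasDerivAt_nonpos (convex_Ici S)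
    (fun s _ => (hasDerivAt_exp_mul (lam1 - ε) ((hv s).const_sub c)).add
      ((hasDerivAt_exp_neg_mul k s).const_mul (C / k))) (fun s hs => by
      have h1 := (hanti self_mem_Ici hs hs).trans (le_abs_self _)
      have h2 : Real.exp ((lam1 - ε) * s) = Real.exp (-(k * s)) * Real.exp ((lam2 + ε) * s) := by
        rw [← Real.exp_add]; congr 1; rw [hk]; ring
      have h3 : C / k * -(k * Real.exp (-(k * s))) = -(C * Real.exp (-(k * s))) := by
        field_simp
      rw [h3, h2]
      have h4 := mul_le_mul_of_nonneg_left h1 (Real.exp_pos (-(k * s))).le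
      linarith)
  refine IsBigO.of_bound
    (Real.exp ((lam1 - ε) * S) * (c - v S) + C / k * Real.exp (-(k * S))) ?_
  filter_upwards [eventually_ge_atTop S] with s hs
  have h1 := hanti2 self_mem_Ici (mem_Ici.2 hs) hs
  simp only [Pi.add_apply] at h1
  rw [Real.norm_of_nonneg (sub_pos.2 (hlt s)).le, Real.norm_of_nonneg (Real.exp_pos _).le,
    Real.exp_neg ((lam1 - ε) * s), ← div_eq_mul_inv, le_div_iff₀ (Real.exp_pos _), mul_comm]
  refine le_trans ?_ h1
  have : 0 ≤ C / k * Real.exp (-(k * s)) := by positivity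
  linarith

end IsEmdenFowlerOrbit

end EmdenFowler

/-! ### Linear equations with an exponentially decaying coefficient -/

/-- `ψ`, with derivative `ψ1`, solves `ψ'' + δ ψ' = κ ψ` on the line with a damping `δ > 0` and a
coefficient `κ ≥ 0`, and it is positive and increasing near `-∞`. -/
structure IsDampedGrowth (δ : ℝ) (κ ψ ψ1 : ℝ → ℝ) : Prop where
  damping_pos : 0 < δ
  coeff_nonneg : ∀ s, 0 ≤ κ s
  hasDerivAt : ∀ s, HasDerivAt ψ (ψ1 s) s
  hasDerivAt_deriv : ∀ s, HasDerivAt ψ1 (-(δ * ψ1 s) + κ s * ψ s) s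
  eventually_pos : ∀ᶠ s in atBot, 0 < ψ s
  eventually_deriv_pos : ∀ᶠ s in atBot, 0 < ψ1 s

namespace IsDampedGrowth

variable {δ θ : ℝ} {κ ψ ψ1 : ℝ → ℝ}

/-- Up to a first zero the function would be increasing, so that there is none. -/
theorem pos (h : IsDampedGrowth δ κ ψ ψ1) (s : ℝ) : 0 < ψ s := by
  obtain ⟨S, hS⟩ := eventually_atBot.1 (h.eventually_pos.and h.eventually_deriv_pos)
  by_contra! hs
  have hSs : S < s := by
    by_contra! hle
    exact absurd (hS s hle).1 (not_lt.2 hs)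
  have hcont : Continuous ψ := continuous_iff_continuousAt.2 fun t => (h.hasDerivAt t).continuousAt
  set Z := Ici S ∩ ψ ⁻¹' Iic 0 with hZ
  have hZc : IsClosed Z := isClosed_Ici.inter (isClosed_Iic.preimage hcont)
  have hZn : Z.Nonempty := ⟨s, hSs.le, hs⟩
  have hZb : BddBelow Z := ⟨S, fun t ht => ht.1⟩
  set s0 := sInf Z with hs0
  have hs0Z : s0 ∈ Z := hZc.csInf_mem hZn hZb
  have hSs0 : S ≤ s0 := hs0Z.1
  have hbefore : ∀ t ∈ Icc S s0, t < s0 → 0 < ψ t := fun t ht hlt => by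
    by_contra! hle
    exact absurd (csInf_le hZb (show t ∈ Z from ⟨ht.1, hle⟩)) (not_le.2 hlt)
  have hm1 : MonotoneOn (fun s => Real.exp (δ * s) * ψ1 s) (Ico S s0) :=
    monotoneOn_of_hasDerivAt_nonneg (convex_Ico S s0)
      (fun t _ => hasDerivAt_exp_mul δ (h.hasDerivAt_deriv t)) fun t ht => by
        have := mul_nonneg (h.coeff_nonneg t) (hbefore t (Ico_subset_Icc_self ht) ht.2).le
        exact mul_nonneg (Real.exp_pos _).le (by linarith)
  have hm2 : MonotoneOn ψ (Icc S s0) := by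
    refine monotoneOn_of_deriv_nonneg (convex_Icc S s0) hcont.continuousOn
      (fun t _ => (h.hasDerivAt t).differentiableAt.differentiableWithinAt) fun t ht => ?_
    rw [interior_Icc] at ht
    rw [(h.hasDerivAt t).deriv]
    have h1 := hm1 (left_mem_Ico.2 (ht.1.trans ht.2)) (Ioo_subset_Ico_self ht) ht.1.le
    have h2 : 0 < Real.exp (δ * S) * ψ1 S := mul_pos (Real.exp_pos _) (hS S le_rfl).2
    exact ((mul_pos_iff_of_pos_left (Real.exp_pos _)).1 (h2.trans_le h1)).le
  have h3 := hm2 (left_mem_Icc.2 hSs0) (right_mem_Icc.2 hSs0) hSs0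
  have h4 : ψ s0 ≤ 0 := hs0Z.2
  linarith [(hS S le_rfl).1]

theorem deriv_pos (h : IsDampedGrowth δ κ ψ ψ1) (s : ℝ) : 0 < ψ1 s := by
  refine pos_of_deriv_add_mul_nonneg δ h.hasDerivAt_deriv (fun s => ?_) h.eventually_deriv_pos s
  have := mul_nonneg (h.coeff_nonneg s) (h.pos s).le
  linarith

theorem monotone (h : IsDampedGrowth δ κ ψ ψ1) : Monotone ψ :=
  monotone_of_hasDerivAt_nonneg h.hasDerivAt fun s => (h.deriv_pos s).le

theorem hasDerivAt_add (h : IsDampedGrowth δ κ ψ ψ1) (s : ℝ) :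
    HasDerivAt (fun s => ψ1 s + δ * ψ s) (κ s * ψ s) s :=
  ((h.hasDerivAt_deriv s).add ((h.hasDerivAt s).const_mul δ)).congr_deriv (by ring)

/-- A Gronwall estimate for the increasing quantity `ψ' + δ ψ`. -/
theorem exists_bound (h : IsDampedGrowth δ κ ψ ψ1) (hθ : 0 < θ)
    (hκ : κ =O[atTop] fun s => Real.exp (-(θ * s))) : ∃ B, ∀ s, ψ1 s + δ * ψ s ≤ B := by
  have hδ := h.damping_pos
  obtain ⟨K, hK0, hK⟩ := hκ.exists_pos
  obtain ⟨S, hS⟩ := eventually_atTop.1 hK.bound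
  set k := K / (δ * θ) with hk
  have hk0 : 0 < k := by positivity
  have hmono : Monotone fun s => ψ1 s + δ * ψ s := monotone_of_hasDerivAt_nonneg h.hasDerivAt_add
    fun s => mul_nonneg (h.coeff_nonneg s) (h.pos s).le
  have hupos : ∀ s, 0 < ψ1 s + δ * ψ s := fun s =>
    add_pos (h.deriv_pos s) (mul_pos hδ (h.pos s))
  have hanti := antitoneOn_of_hasDerivAt_nonpos (convex_Ici S) (fun s _ =>
    ((((hasDerivAt_exp_neg_mul θ s).const_mul k).exp).fun_mul (h.hasDerivAt_add s)))
    (fun s hs => by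
      have h1 := hS s hs
      rw [Real.norm_of_nonneg (h.coeff_nonneg s), Real.norm_of_nonneg (Real.exp_pos _).le] at h1
      have h2 : k * -(θ * Real.exp (-(θ * s))) = -(K * Real.exp (-(θ * s)) / δ) := by
        rw [hk]; field_simp
      have h3 : κ s * ψ s ≤ K * Real.exp (-(θ * s)) / δ * (ψ1 s + δ * ψ s) := by
        calc κ s * ψ s ≤ K * Real.exp (-(θ * s)) * ψ s :=
              mul_le_mul_of_nonneg_right h1 (h.pos s).le
          _ = K * Real.exp (-(θ * s)) / δ * (δ * ψ s) := by field_simp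
          _ ≤ _ := mul_le_mul_of_nonneg_left (by linarith [h.deriv_pos s]) (by positivity)
      rw [h2]
      have h4 := mul_le_mul_of_nonneg_left h3 (Real.exp_pos (k * Real.exp (-(θ * s)))).le
      linarith)
  refine ⟨Real.exp (k * Real.exp (-(θ * S))) * (ψ1 S + δ * ψ S), fun s => ?_⟩
  have hS' := hanti (self_mem_Ici) (show max s S ∈ Ici S from le_max_right s S) (le_max_right s S)
  refine le_trans ?_ hS'
  refine (hmono (le_max_left s S)).trans ?_
  exact le_mul_of_one_le_left (hupos _).le (Real.one_le_exp (by positivity))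

/-- The solution converges to a positive limit, at every exponential rate below both that of the
coefficient and the damping. -/
theorem exists_limit (h : IsDampedGrowth δ κ ψ ψ1) {θ₀ : ℝ} (hθ₀ : 0 < θ₀)
    (hκ : ∀ θ < θ₀, κ =O[atTop] fun s => Real.exp (-(θ * s))) :
    ∃ C, 0 < C ∧ Tendsto ψ atTop (𝓝 C) ∧
      ∀ θ, θ < θ₀ → θ < δ → (fun s => ψ s - C) =O[atTop] fun s => Real.exp (-(θ * s)) := by
  have hδ := h.damping_pos
  obtain ⟨B, hB⟩ := h.exists_bound (half_pos hθ₀) (hκ (θ₀ / 2) (half_lt_self hθ₀))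
  have hmono : Monotone fun s => ψ1 s + δ * ψ s := monotone_of_hasDerivAt_nonneg h.hasDerivAt_add
    fun s => mul_nonneg (h.coeff_nonneg s) (h.pos s).le
  have hbdd : BddAbove (range fun s => ψ1 s + δ * ψ s) := ⟨B, by rintro _ ⟨s, rfl⟩; exact hB s⟩
  have hU := tendsto_atTop_ciSup hmono hbdd
  set U := ⨆ s, (ψ1 s + δ * ψ s) with hUdef
  have huU : ∀ s, ψ1 s + δ * ψ s ≤ U := fun s => le_ciSup hbdd s
  have hUpos : 0 < U :=
    (add_pos (h.deriv_pos 0) (mul_pos hδ (h.pos 0))).trans_le (huU 0)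
  have hBpos : 0 < B := (add_pos (h.deriv_pos 0) (mul_pos hδ (h.pos 0))).trans_le (hB 0)
  -- The rate for positive exponents; the others follow.
  have key : ∀ θ, 0 < θ → θ < θ₀ → θ < δ →
      (fun s => ψ s - U / δ) =O[atTop] fun s => Real.exp (-(θ * s)) := by
    intro θ hθ hθ' hθδ
    obtain ⟨K, hK0, hK⟩ := (hκ θ hθ').exists_pos
    obtain ⟨S, hS⟩ := eventually_atTop.1 hK.bound
    set k := K * (B / δ) / θ with hk
    have hk0 : 0 < k := by positivity
    have hanti := antitoneOn_of_hasDerivAt_nonpos (convex_Ici S) (fun s _ =>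
      (h.hasDerivAt_add s).fun_add ((hasDerivAt_exp_neg_mul θ s).const_mul k)) (fun s hs => by
        have h1 := hS s hs
        rw [Real.norm_of_nonneg (h.coeff_nonneg s), Real.norm_of_nonneg (Real.exp_pos _).le] at h1
        have h2 : k * -(θ * Real.exp (-(θ * s))) = -(K * Real.exp (-(θ * s)) * (B / δ)) := by
          rw [hk]; field_simp
        have h3 : ψ s ≤ B / δ := by
          rw [le_div_iff₀ hδ]; linarith [hB s, h.deriv_pos s]
        have h4 := mul_le_mul h1 h3 (h.pos s).le (by positivity)
        linarith)
    have hexp0 : Tendsto (fun s => Real.exp (-(θ * s))) atTop (𝓝 0) :=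
      Real.tendsto_exp_neg_atTop_nhds_zero.comp (tendsto_id.const_mul_atTop hθ)
    have hgap : ∀ s, S ≤ s → U - (ψ1 s + δ * ψ s) ≤ k * Real.exp (-(θ * s)) := by
      intro s hs
      have hlim : Tendsto (fun t => ψ1 t + δ * ψ t + k * Real.exp (-(θ * t))) atTop
          (𝓝 (U + k * 0)) := hU.add (hexp0.const_mul k)
      have := le_of_tendsto hlim (by
        filter_upwards [eventually_ge_atTop s] with t ht
        exact hanti hs (hs.trans ht) ht)
      simp only [mul_zero, add_zero] at this
      linarith
    have he : ∀ s, HasDerivAt (fun s => ψ s - U / δ) (ψ1 s) s := fun s =>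
      (h.hasDerivAt s).sub_const _
    -- Since `ψ' + δ (ψ - U / δ) = ψ' + δ ψ - U`, the gap just estimated controls `ψ - U / δ` from
    -- both sides.
    have hup := antitoneOn_of_hasDerivAt_nonpos (convex_Ici S)
      (fun s _ => hasDerivAt_exp_mul δ (he s)) (fun s _ => by
        refine mul_nonpos_of_nonneg_of_nonpos (Real.exp_pos _).le ?_
        have h2 : δ * (ψ s - U / δ) = δ * ψ s - U := by field_simp
        linarith [huU s])
    have hlow := monotoneOn_of_hasDerivAt_nonneg (convex_Ici S)
      (fun s _ => (hasDerivAt_exp_mul δ (he s)).fun_add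
        ((hasDerivAt_exp_neg_mul (θ - δ) s).const_mul (k / (δ - θ)))) (fun s hs => by
        have h2 : δ * (ψ s - U / δ) = δ * ψ s - U := by field_simp
        have h3 : Real.exp (-((θ - δ) * s)) = Real.exp (δ * s) * Real.exp (-(θ * s)) := by
          rw [← Real.exp_add]; congr 1; ring
        have hne : δ - θ ≠ 0 := by linarith
        have h4 : k / (δ - θ) * -((θ - δ) * Real.exp (-((θ - δ) * s))) =
            Real.exp (δ * s) * (k * Real.exp (-(θ * s))) := by
          rw [h3]; field_simp; ring
        rw [h4, ← mul_add]
        exact mul_nonneg (Real.exp_pos _).le (by linarith [hgap s hs]))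
    set A := |Real.exp (δ * S) * (ψ S - U / δ)| with hA
    have hθδ' : 0 < δ - θ := by linarith
    refine IsBigO.of_bound (A + k / (δ - θ)) ?_
    filter_upwards [eventually_ge_atTop S, eventually_ge_atTop 0] with s hs hs0
    rw [Real.norm_of_nonneg (Real.exp_pos _).le, Real.norm_eq_abs]
    have h1 := hup self_mem_Ici (mem_Ici.2 hs) hs
    have h2 := hlow self_mem_Ici (mem_Ici.2 hs) hs
    simp only at h1 h2
    have hE : Real.exp (-((θ - δ) * s)) = Real.exp (δ * s) * Real.exp (-(θ * s)) := by
      rw [← Real.exp_add]; congr 1; ring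
    have hE1 : 1 ≤ Real.exp (δ * s) * Real.exp (-(θ * s)) := by
      rw [← hE]; exact Real.one_le_exp (by nlinarith)
    have h3 : 0 ≤ k / (δ - θ) * Real.exp (-((θ - δ) * S)) := by positivity
    have hA0 : 0 ≤ A := abs_nonneg _
    have hA1 : A ≤ A * (Real.exp (δ * s) * Real.exp (-(θ * s))) := le_mul_of_one_le_right hA0 hE1
    have hkk : 0 ≤ k / (δ - θ) * (Real.exp (δ * s) * Real.exp (-(θ * s))) := by positivity
    rw [hE] at h2
    have hpos := Real.exp_pos (δ * s)
    rw [abs_le]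
    constructor
    · refine le_of_mul_le_mul_left ?_ hpos
      have := neg_abs_le (Real.exp (δ * S) * (ψ S - U / δ))
      nlinarith
    · refine le_of_mul_le_mul_left ?_ hpos
      have := le_abs_self (Real.exp (δ * S) * (ψ S - U / δ))
      nlinarith
  refine ⟨U / δ, by positivity, ?_, ?_⟩
  · set θ := min θ₀ δ / 2 with hθ
    have hmin : 0 < min θ₀ δ := lt_min hθ₀ hδ
    have h1 := key θ (half_pos hmin) ((half_lt_self hmin).trans_le (min_le_left _ _))
      ((half_lt_self hmin).trans_le (min_le_right _ _))
    have hexp0 : Tendsto (fun s => Real.exp (-(θ * s))) atTop (𝓝 0) :=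
      Real.tendsto_exp_neg_atTop_nhds_zero.comp (tendsto_id.const_mul_atTop (half_pos hmin))
    simpa using (h1.trans_tendsto hexp0).add_const (U / δ)
  · intro θ h1 h2
    have hmin : 0 < min θ₀ δ := lt_min hθ₀ hδ
    have h3 := key (max θ (min θ₀ δ / 2)) (lt_max_of_lt_right (half_pos hmin))
      (max_lt h1 ((half_lt_self hmin).trans_le (min_le_left _ _)))
      (max_lt h2 ((half_lt_self hmin).trans_le (min_le_right _ _)))
    refine h3.trans (IsBigO.of_bound 1 ?_)
    filter_upwards [eventually_ge_atTop 0] with s hs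
    rw [one_mul, Real.norm_of_nonneg (Real.exp_pos _).le, Real.norm_of_nonneg (Real.exp_pos _).le]
    refine Real.exp_le_exp.2 (neg_le_neg (mul_le_mul_of_nonneg_right (le_max_left _ _) hs))

end IsDampedGrowth

/-! ### The exponents above the Joseph–Lundgren threshold -/

section Exponents

variable {d p : ℕ}

theorem pJL_denom_pos (hd : 11 ≤ d) : 0 < (d : ℝ) - 4 - 2 * √((d : ℝ) - 1) := by
  have hd' : (11 : ℝ) ≤ d := by exact_mod_cast hd
  have : √((d : ℝ) - 1) < ((d : ℝ) - 4) / 2 :=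
    (Real.sqrt_lt' (by linarith)).2 (by nlinarith)
  linarith

theorem one_lt_of_pJL_lt (hd : 11 ≤ d) (hp : pJL d < p) : (1 : ℝ) < p :=
  lt_trans (lt_add_of_pos_right _ (div_pos four_pos (pJL_denom_pos hd))) hp

theorem two_le_of_pJL_lt (hd : 11 ≤ d) (hp : pJL d < p) : 2 ≤ p := by
  have := one_lt_of_pJL_lt hd hp
  exact_mod_cast this

theorem scaling_pos (hd : 11 ≤ d) (hp : pJL d < p) : 0 < 2 / ((p : ℝ) - 1) :=
  div_pos two_pos (by linarith [one_lt_of_pJL_lt hd hp])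

theorem scaling_mul (hd : 11 ≤ d) (hp : pJL d < p) :
    2 / ((p : ℝ) - 1) * p = 2 / ((p : ℝ) - 1) + 2 := by
  have : (p : ℝ) - 1 ≠ 0 := by linarith [one_lt_of_pJL_lt hd hp]
  field_simp
  ring

theorem scaling_lt (hd : 11 ≤ d) (hp : pJL d < p) :
    2 * (2 / ((p : ℝ) - 1)) < (d : ℝ) - 4 - 2 * √((d : ℝ) - 1) := by
  have h1 := pJL_denom_pos hd
  have h2 := one_lt_of_pJL_lt hd hp
  rw [pJL] at hp
  have h3 : 4 / ((d : ℝ) - 4 - 2 * √((d : ℝ) - 1)) < p - 1 := by linarith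
  rw [div_lt_iff₀ h1] at h3
  rw [← mul_div_assoc, div_lt_iff₀ (by linarith)]
  linarith

theorem cInfty_base_pos (hd : 11 ≤ d) (hp : pJL d < p) :
    0 < 2 / ((p : ℝ) - 1) * ((d : ℝ) - 2 - 2 / ((p : ℝ) - 1)) := by
  have h1 := scaling_pos hd hp
  have h2 := scaling_lt hd hp
  have h3 := Real.sqrt_nonneg ((d : ℝ) - 1)
  exact mul_pos h1 (by linarith)

theorem cInfty_pos (hd : 11 ≤ d) (hp : pJL d < p) : 0 < cInfty d p :=
  Real.rpow_pos_of_pos (cInfty_base_pos hd hp) _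

theorem cInfty_pow (hd : 11 ≤ d) (hp : pJL d < p) :
    cInfty d p ^ (p - 1) = 2 / ((p : ℝ) - 1) * ((d : ℝ) - 2 - 2 / ((p : ℝ) - 1)) := by
  have h1 : ((p - 1 : ℕ) : ℝ) = p - 1 := by
    rw [Nat.cast_sub (by have := two_le_of_pJL_lt hd hp; omega), Nat.cast_one]
  have h2 : (p : ℝ) - 1 ≠ 0 := by linarith [one_lt_of_pJL_lt hd hp]
  rw [cInfty, ← Real.rpow_natCast, ← Real.rpow_mul (cInfty_base_pos hd hp).le, h1,
    one_div_mul_cancel h2, Real.rpow_one]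

theorem discr_eq_sq_sub (n : ℕ) :
    discr d p n = ((d : ℝ) - 2 + 2 * n) ^ 2 - 4 * p * cInfty d p ^ (p - 1) := by
  rw [discr]; ring

theorem p_mul_cInfty_pow (hd : 11 ≤ d) (hp : pJL d < p) :
    (p : ℝ) * cInfty d p ^ (p - 1) =
      (2 / ((p : ℝ) - 1) + 2) * ((d : ℝ) - 2 - 2 / ((p : ℝ) - 1)) := by
  rw [cInfty_pow hd hp, ← scaling_mul hd hp]; ring

/-- The Joseph–Lundgren condition makes the discriminant positive, since the latter equals
`(d - 4 - 2 m) ^ 2 - 4 (d - 1)` with `m = 2 / (p - 1)`. -/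
theorem discr_zero_pos (hd : 11 ≤ d) (hp : pJL d < p) : 0 < discr d p 0 := by
  have h2 := scaling_lt hd hp
  have hd' : (11 : ℝ) ≤ d := by exact_mod_cast hd
  have h3 := Real.sqrt_nonneg ((d : ℝ) - 1)
  have h4 := Real.sq_sqrt (show (0 : ℝ) ≤ (d : ℝ) - 1 by linarith)
  set m := 2 / ((p : ℝ) - 1) with hm
  have h5 : discr d p 0 = ((d : ℝ) - 4 - 2 * m) ^ 2 - 4 * ((d : ℝ) - 1) := by
    rw [discr, mul_assoc 4, p_mul_cInfty_pow hd hp, ← hm]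
    push_cast
    ring
  rw [h5]
  nlinarith

theorem discr_zero_le (hd : 11 ≤ d) (n : ℕ) : discr d p 0 ≤ discr d p n := by
  have hd' : (11 : ℝ) ≤ d := by exact_mod_cast hd
  have hn : (0 : ℝ) ≤ n := n.cast_nonneg
  rw [discr_eq_sq_sub, discr_eq_sq_sub]
  push_cast
  nlinarith

theorem discr_pos (hd : 11 ≤ d) (hp : pJL d < p) (n : ℕ) : 0 < discr d p n :=
  (discr_zero_pos hd hp).trans_le (discr_zero_le hd n)

theorem sqrt_discr (n : ℕ) : √(discr d p n) = (d : ℝ) - 2 - 2 * gammaExp d p n := by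
  rw [gammaExp]; ring

theorem gammaExp_equation (hd : 11 ≤ d) (hp : pJL d < p) (n : ℕ) :
    (gammaExp d p n + n) * ((d : ℝ) - 2 + n - gammaExp d p n) = p * cInfty d p ^ (p - 1) := by
  have h := Real.sq_sqrt (discr_pos hd hp n).le
  rw [sqrt_discr, discr_eq_sq_sub] at h
  linarith

theorem gammaExp_add_pos (hd : 11 ≤ d) (hp : pJL d < p) (n : ℕ) : 0 < gammaExp d p n + n := by
  have hd' : (11 : ℝ) ≤ d := by exact_mod_cast hd
  have h0 : 0 < (p : ℝ) * cInfty d p ^ (p - 1) :=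
    mul_pos (by linarith [one_lt_of_pJL_lt hd hp]) (pow_pos (cInfty_pos hd hp) _)
  have : √(discr d p n) < (d : ℝ) - 2 + 2 * n :=
    (Real.sqrt_lt' (by have := n.cast_nonneg (α := ℝ); linarith)).2 (by
      rw [discr_eq_sq_sub]; linarith)
  rw [gammaExp]
  linarith

/-- The exponents `α` and `α + √△₀` are the decay rates of the linearization of the Emden–Fowler
equation at `c_∞`. -/
theorem alphaExp_mul (hd : 11 ≤ d) (hp : pJL d < p) :
    alphaExp d p * (alphaExp d p + √(discr d p 0)) = ((p : ℝ) - 1) * cInfty d p ^ (p - 1) := by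
  have h := gammaExp_equation hd hp 0
  have h1 := cInfty_pow hd hp
  rw [sqrt_discr, alphaExp, sub_mul _ 1, ← h, one_mul, h1]
  push_cast
  ring

theorem alphaExp_pos (hd : 11 ≤ d) (hp : pJL d < p) : 0 < alphaExp d p := by
  have h1 := alphaExp_mul hd hp
  have h2 : 0 < ((p : ℝ) - 1) * cInfty d p ^ (p - 1) :=
    mul_pos (by linarith [one_lt_of_pJL_lt hd hp]) (pow_pos (cInfty_pos hd hp) _)
  have h3 : 2 * alphaExp d p + √(discr d p 0) = (d : ℝ) - 2 - 2 * (2 / ((p : ℝ) - 1)) := by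
    rw [sqrt_discr, alphaExp]; ring
  have h4 := scaling_lt hd hp
  have h5 := Real.sqrt_nonneg ((d : ℝ) - 1)
  have h6 := Real.sqrt_nonneg (discr d p 0)
  by_contra! h
  nlinarith

end Exponents

/-! ### Passage to logarithmic variables -/

theorem hasDerivAt_exp_mul_comp_exp {f : ℝ → ℝ} {f' s : ℝ} (mu : ℝ)
    (hf : HasDerivAt f f' (Real.exp s)) :
    HasDerivAt (fun s => Real.exp (mu * s) * f (Real.exp s))
      (Real.exp (mu * s) * (mu * f (Real.exp s) + Real.exp s * f')) s :=
  (hasDerivAt_exp_mul mu (hf.comp s (Real.hasDerivAt_exp s))).congr_deriv (by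
    simp only [Function.comp_apply]; ring)

/-- The derivative of the factor `μ f + r f'` which arises when `e ^ (μ s) f (e ^ s)` is
differentiated in `s`. -/
theorem hasDerivAt_euler {f : ℝ → ℝ} (hf : ContDiff ℝ ∞ f) (mu r : ℝ) :
    HasDerivAt (fun r => mu * f r + r * deriv f r)
      (mu * deriv f r + (deriv f r + r * deriv (deriv f) r)) r :=
  ((hasDerivAt_of_contDiff hf r).const_mul mu).fun_add
    (((hasDerivAt_id' r).fun_mul (hasDerivAt_of_contDiff (contDiff_deriv hf) r)).congr_deriv
      (by ring))

theorem tendsto_exp_mul_atBot {mu : ℝ} (hmu : 0 < mu) :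
    Tendsto (fun s => Real.exp (mu * s)) atBot (𝓝 0) :=
  Real.tendsto_exp_atBot.comp (tendsto_id.const_mul_atBot hmu)

theorem tendsto_comp_exp_atBot {f : ℝ → ℝ} (hf : Continuous f) :
    Tendsto (fun s => f (Real.exp s)) atBot (𝓝 (f 0)) :=
  (hf.tendsto 0).comp Real.tendsto_exp_atBot

theorem eventually_exp_mul_comp_exp_pos {f : ℝ → ℝ} (hf : Continuous f) (h0 : 0 < f 0) (mu : ℝ) :
    ∀ᶠ s in atBot, 0 < Real.exp (mu * s) * f (Real.exp s) :=
  ((tendsto_comp_exp_atBot hf).eventually (lt_mem_nhds h0)).mono fun _ hs =>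
    mul_pos (Real.exp_pos _) hs

section LogVariables

variable {d p : ℕ} {Q : Eucl d → ℝ}

/-- The ground state in Emden–Fowler variables, `v (s) = r ^ (2 / (p - 1)) Q (r)` with
`r = e ^ s`. -/
noncomputable def emdenProfile (p : ℕ) (Q : Eucl d → ℝ) (s : ℝ) : ℝ :=
  Real.exp (2 / ((p : ℝ) - 1) * s) * radialProfile Q (Real.exp s)

theorem emdenProfile_pow (hd : 11 ≤ d) (hp : pJL d < p) (s : ℝ) :
    emdenProfile p Q s ^ (p - 1) = Real.exp s ^ 2 * radialProfile Q (Real.exp s) ^ (p - 1) := by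
  rw [emdenProfile, mul_pow, ← Real.exp_nat_mul, ← Real.exp_nat_mul]
  congr 2
  have h2 : (p : ℝ) - 1 ≠ 0 := by linarith [one_lt_of_pJL_lt hd hp]
  rw [Nat.cast_sub (by have := two_le_of_pJL_lt hd hp; omega)]
  push_cast
  field_simp

theorem IsGroundState.isEmdenFowlerOrbit (hd : 11 ≤ d) (hp : pJL d < p)
    (hQ : IsGroundState d p Q) :
    IsEmdenFowlerOrbit p ((d : ℝ) - 2 - 2 * (2 / ((p : ℝ) - 1))) (cInfty d p) (alphaExp d p)
      (alphaExp d p + √(discr d p 0)) (emdenProfile p Q)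
      (fun s => Real.exp (2 / ((p : ℝ) - 1) * s) *
        (2 / ((p : ℝ) - 1) * radialProfile Q (Real.exp s) +
          Real.exp s * deriv (radialProfile Q) (Real.exp s))) := by
  have hd0 : 0 < d := by omega
  have hq := contDiff_radialProfile hd0 hQ.smooth
  have hqc := hq.continuous
  have hq'c := (contDiff_deriv hq).continuous
  have hm := scaling_pos hd hp
  have h2p := two_le_of_pJL_lt hd hp
  have hpow := emdenProfile_pow (Q := Q) hd hp
  have hc := cInfty_pow hd hp
  refine ⟨cInfty_pos hd hp, h2p, alphaExp_pos hd hp,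
    lt_add_of_pos_right _ (Real.sqrt_pos.2 (discr_zero_pos hd hp)), ?_, alphaExp_mul hd hp, ?_, ?_,
    fun s => mul_pos (Real.exp_pos _) (hQ.profile_pos _), ?_, ?_, ?_⟩
  · rw [sqrt_discr, alphaExp]; ring
  · exact fun s => hasDerivAt_exp_mul_comp_exp _ (hasDerivAt_of_contDiff hq _)
  · intro s
    refine (hasDerivAt_exp_mul_comp_exp _ (hasDerivAt_euler hq _ _)).congr_deriv ?_
    have h3 : emdenProfile p Q s ^ p = Real.exp (2 / ((p : ℝ) - 1) * s) *
        (Real.exp s ^ 2 * radialProfile Q (Real.exp s) ^ p) := by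
      have hsplit : ∀ x : ℝ, x ^ p = x ^ (p - 1) * x := fun x => by
        rw [← pow_succ, Nat.sub_add_cancel (by omega)]
      rw [hsplit, hsplit, hpow, emdenProfile]
      ring
    rw [h3, hc, hQ.deriv_deriv_profile hd0 (Real.exp_pos s), emdenProfile]
    have := (Real.exp_pos s).ne'
    field_simp
    ring
  · have := (tendsto_exp_mul_atBot hm).mul (tendsto_comp_exp_atBot hqc)
    rwa [zero_mul] at this
  · simpa using (tendsto_exp_mul_atBot hm).mul (tendsto_comp_exp_atBot
      (show Continuous fun r => 2 / ((p : ℝ) - 1) * radialProfile Q r +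
        r * deriv (radialProfile Q) r by fun_prop))
  · refine eventually_exp_mul_comp_exp_pos
      (show Continuous fun r => 2 / ((p : ℝ) - 1) * radialProfile Q r +
        r * deriv (radialProfile Q) r by fun_prop) ?_ _
    rw [hQ.profile_zero hd0]
    simpa using one_lt_of_pJL_lt hd hp

/-- `r ^ n φ (r)` is a solution of `H⁽ⁿ⁾ f = 0` which is regular at the origin: `φ` is smooth and
even on the whole line, positive at `0`, and solves the equation obtained by removing the factor
`r ^ n`. -/
structure IsRegularFactor (d p : ℕ) (Q : Eucl d → ℝ) (n : ℕ) (φ : ℝ → ℝ) : Prop where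
  smooth : ContDiff ℝ ∞ φ
  even : φ.Even
  zero_pos : 0 < φ 0
  equation : ∀ r, 0 < r → deriv (deriv φ) r =
    -(((d : ℝ) + 2 * n - 1) / r * deriv φ r) - p * radialProfile Q r ^ (p - 1) * φ r

/-- The factor `ψ` in `T = r ^ (-γ_n) ψ (log r)`, for `T = r ^ n φ (r)`. -/
noncomputable def logFactor (d p n : ℕ) (φ : ℝ → ℝ) (s : ℝ) : ℝ :=
  Real.exp ((gammaExp d p n + n) * s) * φ (Real.exp s)

/-- Removing the factor `r ^ (-γ_n)` turns `H⁽ⁿ⁾ f = 0` into a damped equation whose coefficient is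
the difference of the Hardy potential and the potential of `H⁽ⁿ⁾`. The difference is positive and
decays since `r ^ (2 / (p - 1)) Q` increases to `c_∞`. -/
theorem IsRegularFactor.isDampedGrowth (hd : 11 ≤ d) (hp : pJL d < p) (hQ : IsGroundState d p Q)
    {n : ℕ} {φ : ℝ → ℝ} (h : IsRegularFactor d p Q n φ) :
    IsDampedGrowth √(discr d p n)
      (fun s => p * (cInfty d p ^ (p - 1) - emdenProfile p Q s ^ (p - 1)))
      (logFactor d p n φ) (fun s => Real.exp ((gammaExp d p n + n) * s) *
        ((gammaExp d p n + n) * φ (Real.exp s) + Real.exp s * deriv φ (Real.exp s))) := by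
  have horb := hQ.isEmdenFowlerOrbit hd hp
  have hφc := h.smooth.continuous
  have hφ'c := (contDiff_deriv h.smooth).continuous
  refine ⟨Real.sqrt_pos.2 (discr_pos hd hp n), fun s => ?_, fun s =>
    hasDerivAt_exp_mul_comp_exp _ (hasDerivAt_of_contDiff h.smooth _), fun s => ?_,
    eventually_exp_mul_comp_exp_pos hφc h.zero_pos _, ?_⟩
  · exact mul_nonneg p.cast_nonneg (sub_nonneg.2
      (pow_le_pow_left₀ (horb.pos s).le (horb.lt s).le _))
  · refine (hasDerivAt_exp_mul_comp_exp _ (hasDerivAt_euler h.smooth _ _)).congr_deriv ?_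
    rw [mul_sub, ← gammaExp_equation hd hp n, emdenProfile_pow hd hp, sqrt_discr,
      h.equation _ (Real.exp_pos s), logFactor]
    have := (Real.exp_pos s).ne'
    field_simp
    ring
  · refine eventually_exp_mul_comp_exp_pos
      (show Continuous fun r => (gammaExp d p n + n) * φ r + r * deriv φ r by fun_prop) ?_ _
    simpa using mul_pos (gammaExp_add_pos hd hp n) h.zero_pos

theorem IsGroundState.isBigO_potential (hd : 11 ≤ d) (hp : pJL d < p) (hQ : IsGroundState d p Q)
    {θ : ℝ} (hθ : θ < alphaExp d p) :
    (fun s => (p : ℝ) * (cInfty d p ^ (p - 1) - emdenProfile p Q s ^ (p - 1))) =O[atTop]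
      fun s => Real.exp (-(θ * s)) := by
  have horb := hQ.isEmdenFowlerOrbit hd hp
  have h1 := ((hasDerivAt_pow (p - 1) (cInfty d p)).isBigO_sub.comp_tendsto horb.tendsto)
  have h2 : (fun s => emdenProfile p Q s - cInfty d p) =O[atTop] fun s => Real.exp (-(θ * s)) :=
    (horb.isBigO hθ).neg_left.congr_left fun s => by ring
  have h3 := (h1.trans h2).neg_left.const_mul_left (p : ℝ)
  exact h3.congr_left fun s => by simp

variable {n : ℕ} {φ : ℝ → ℝ}

theorem IsRegularFactor.pos (hd : 11 ≤ d) (hp : pJL d < p) (hQ : IsGroundState d p Q)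
    (h : IsRegularFactor d p Q n φ) {r : ℝ} (hr : 0 < r) : 0 < φ r := by
  have := (h.isDampedGrowth hd hp hQ).pos (Real.log r)
  rw [logFactor, Real.exp_log hr] at this
  exact (mul_pos_iff_of_pos_left (Real.exp_pos _)).1 this

theorem pow_mul_eq_rpow_mul_logFactor {r : ℝ} (hr : 0 < r) :
    r ^ n * φ r = r ^ (-gammaExp d p n) * logFactor d p n φ (Real.log r) := by
  rw [logFactor, Real.exp_log hr, ← mul_assoc, Real.rpow_def_of_pos hr, ← Real.exp_add,
    ← Real.rpow_natCast, Real.rpow_def_of_pos hr]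
  congr 2
  ring

theorem IsRegularFactor.exists_asymptotics (hd : 11 ≤ d) (hp : pJL d < p)
    (hQ : IsGroundState d p Q) (h : IsRegularFactor d p Q n φ) :
    ∃ C, 0 < C ∧ (fun r => r ^ n * φ r) ~[atTop] (fun r => C * r ^ (-gammaExp d p n)) ∧
      ∀ ε : ℝ, 0 < ε → (fun r => r ^ n * φ r - C * r ^ (-gammaExp d p n)) =O[atTop]
        fun r => r ^ (-gammaExp d p n - gExp d p ε) := by
  obtain ⟨C, hC, hlim, hrate⟩ := (h.isDampedGrowth hd hp hQ).exists_limit (alphaExp_pos hd hp)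
    fun θ hθ => hQ.isBigO_potential hd hp hθ
  refine ⟨C, hC, ?_, fun ε hε => ?_⟩
  · have h1 : Tendsto (fun r => C⁻¹ * logFactor d p n φ (Real.log r)) atTop (𝓝 1) := by
      have := (hlim.comp Real.tendsto_log_atTop).const_mul C⁻¹
      rwa [inv_mul_cancel₀ hC.ne'] at this
    refine isEquivalent_of_tendsto_one (h1.congr' ?_)
    filter_upwards [eventually_gt_atTop 0] with r hr
    have := Real.rpow_pos_of_pos hr (-gammaExp d p n)
    simp only [Pi.div_apply]
    rw [pow_mul_eq_rpow_mul_logFactor (d := d) (p := p) hr]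
    field_simp
  · have h1 : gExp d p ε < alphaExp d p := by
      rw [gExp]; linarith [min_le_left (alphaExp d p) √(discr d p 0)]
    have h2 : gExp d p ε < √(discr d p n) := by
      rw [gExp]
      linarith [min_le_right (alphaExp d p) √(discr d p 0),
        Real.sqrt_le_sqrt (discr_zero_le (p := p) hd n)]
    have h3 := ((isBigO_refl (fun r : ℝ => r ^ (-gammaExp d p n)) atTop).mul
      ((hrate _ h1 h2).comp_tendsto Real.tendsto_log_atTop))
    refine h3.congr' ?_ ?_
    · filter_upwards [eventually_gt_atTop 0] with r hr
      rw [pow_mul_eq_rpow_mul_logFactor (d := d) (p := p) hr]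
      simp only [Function.comp_apply]
      ring
    · filter_upwards [eventually_gt_atTop 0] with r hr
      rw [sub_eq_add_neg, Real.rpow_add hr, Real.rpow_def_of_pos hr (-gExp d p ε)]
      simp only [Function.comp_apply]
      congr 2
      ring

end LogVariables

/-! ### Construction of the regular solution -/

theorem abs_segMean_le (k j : ℕ) {g : ℝ → ℝ} {B r : ℝ}
    (hB : ∀ ρ, |ρ| ≤ |r| → |g ρ| ≤ B * |ρ| ^ j) :
    |segMean k g r| ≤ B * |r| ^ j / (k + j + 1) := by
  have h1 : ∫ t in (0 : ℝ)..1, t ^ (k + j) * (B * |r| ^ j) = B * |r| ^ j / (k + j + 1) := by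
    rw [intervalIntegral.integral_mul_const, integral_pow]
    push_cast
    simp
    ring
  rw [segMean, ← Real.norm_eq_abs, ← h1]
  refine intervalIntegral.norm_integral_le_of_norm_le zero_le_one
    (Eventually.of_forall fun t ht => ?_) (Continuous.intervalIntegrable (by fun_prop) _ _)
  have hle : |t * r| ≤ |r| := by
    rw [abs_mul, abs_of_pos ht.1]
    exact mul_le_of_le_one_left (abs_nonneg r) ht.2
  have h2 := hB _ hle
  rw [abs_mul, abs_of_pos ht.1, mul_pow] at h2
  rw [norm_mul, norm_pow, Real.norm_of_nonneg ht.1.le, Real.norm_eq_abs, pow_add]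
  calc t ^ k * |g (t * r)| ≤ t ^ k * (B * (t ^ j * |r| ^ j)) :=
        mul_le_mul_of_nonneg_left h2 (pow_nonneg ht.1.le k)
    _ = _ := by ring

/-- Locally uniformly summable series of continuous functions can be averaged term by term. -/
theorem continuous_tsum_and_hasSum_segMean (k : ℕ) {g : ℕ → ℝ → ℝ} {b : ℝ → ℕ → ℝ}
    (hg : ∀ i, Continuous (g i)) (hs : ∀ R, Summable (b R))
    (hb : ∀ R i r, |r| ≤ R → |g i r| ≤ b R i) :
    Continuous (fun r => ∑' i, g i r) ∧
      ∀ r, HasSum (fun i => segMean k (g i) r) (segMean k (fun r => ∑' i, g i r) r) := by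
  have hc : Continuous fun r => ∑' i, g i r := by
    refine continuous_iff_continuousAt.2 fun r => ?_
    have h1 : ContinuousOn (fun r => ∑' i, g i r) (Metric.closedBall 0 (|r| + 1)) :=
      continuousOn_tsum (fun i => (hg i).continuousOn) (hs (|r| + 1)) fun i x hx =>
        hb _ i x (by simpa using hx)
    refine h1.continuousAt (mem_of_superset (Metric.ball_mem_nhds r one_pos) fun x hx => ?_)
    have h2 : |x - r| < 1 := by simpa [Real.dist_eq] using hx
    have h3 := abs_sub_abs_le_abs_sub x r
    rw [mem_closedBall_zero_iff, Real.norm_eq_abs]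
    linarith
  refine ⟨hc, fun r => ?_⟩
  refine intervalIntegral.hasSum_integral_of_dominated_convergence
    (F := fun i t => t ^ k * g i (t * r)) (fun i _ => b |r| i) (fun i => ?_)
    (fun i => Eventually.of_forall fun t ht => ?_) (Eventually.of_forall fun t _ => hs |r|)
    intervalIntegrable_const (Eventually.of_forall fun t ht => ?_)
  · have h1 : Continuous fun t : ℝ => t ^ k * g i (t * r) :=
      (continuous_pow k).mul ((hg i).comp (continuous_mul_const r))
    exact h1.aestronglyMeasurable
  all_goals
    rw [uIoc_of_le zero_le_one] at ht
    have hle : |t * r| ≤ |r| := by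
      rw [abs_mul, abs_of_pos ht.1]
      exact mul_le_of_le_one_left (abs_nonneg r) ht.2
  · rw [norm_mul, norm_pow, Real.norm_of_nonneg ht.1.le, Real.norm_eq_abs]
    exact (mul_le_of_le_one_left (abs_nonneg _) (pow_le_one₀ ht.1.le ht.2)).trans (hb _ i _ hle)
  · have h1 : Summable fun i => g i (t * r) :=
      Summable.of_norm_bounded (hs |r|) fun i => hb _ i _ hle
    exact h1.hasSum.mul_left (t ^ k)

/-- The Picard iterates of `φ'' + (M / r) φ' + W φ = 0`, `φ 0 = 1`, `φ' 0 = 0`; the solution is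
their sum. -/
noncomputable def picardTerm (M : ℕ) (W : ℝ → ℝ) : ℕ → ℝ → ℝ
  | 0 => fun _ => 1
  | i + 1 => fun r => -(r ^ 2 * segMean 1 (segMean M fun ρ => W ρ * picardTerm M W i ρ) r)

theorem continuous_picardTerm (M : ℕ) {W : ℝ → ℝ} (hW : Continuous W) (i : ℕ) :
    Continuous (picardTerm M W i) := by
  induction i with
  | zero => exact continuous_const
  | succ i ih =>
    have := continuous_segMean 1 (continuous_segMean M (hW.mul ih))
    exact ((continuous_pow 2).mul this).neg

theorem even_picardTerm (M : ℕ) {W : ℝ → ℝ} (hW : W.Even) (i : ℕ) : (picardTerm M W i).Even := by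
  induction i with
  | zero => exact fun _ => rfl
  | succ i ih =>
    intro r
    have := even_segMean 1 (even_segMean M (g := fun ρ => W ρ * picardTerm M W i ρ)
      fun ρ => by simp only [hW ρ, ih ρ]) r
    simp only [picardTerm, this, neg_sq]

theorem abs_picardTerm_le (M : ℕ) {W : ℝ → ℝ} {K R : ℝ} (hK : 0 ≤ K)
    (hW : ∀ r, |r| ≤ R → |W r| ≤ K) (i : ℕ) (r : ℝ) (hr : |r| ≤ R) :
    |picardTerm M W i r| ≤ (K / 2) ^ i / i.factorial * |r| ^ (2 * i) := by
  induction i generalizing r with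
  | zero => simp [picardTerm]
  | succ i ih =>
    have h1 : ∀ ρ, |ρ| ≤ |r| → |segMean M (fun ρ => W ρ * picardTerm M W i ρ) ρ| ≤
        K * ((K / 2) ^ i / i.factorial) * |ρ| ^ (2 * i) := fun ρ hρ => by
      refine (abs_segMean_le M (2 * i) (B := K * ((K / 2) ^ i / i.factorial))
        fun σ hσ => ?_).trans (div_le_self (by positivity) ?_)
      · have hσR := (hσ.trans hρ).trans hr
        rw [abs_mul, mul_assoc]
        exact mul_le_mul (hW σ hσR) (ih σ hσR) (abs_nonneg _) hK
      · push_cast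
        have : (0 : ℝ) ≤ M := M.cast_nonneg
        have : (0 : ℝ) ≤ i := i.cast_nonneg
        linarith
    have h2 := abs_segMean_le 1 (2 * i) h1
    rw [picardTerm, abs_neg, abs_mul, abs_pow]
    refine (mul_le_mul_of_nonneg_left h2 (by positivity)).trans (le_of_eq ?_)
    rw [Nat.factorial_succ]
    push_cast
    have : (i.factorial : ℝ) ≠ 0 := by exact_mod_cast i.factorial_ne_zero
    field_simp
    ring

theorem exists_regular_solution (M : ℕ) {W : ℝ → ℝ} (hW : ContDiff ℝ ∞ W) (hWe : W.Even) :
    ∃ φ : ℝ → ℝ, ContDiff ℝ ∞ φ ∧ φ.Even ∧ φ 0 = 1 ∧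
      ∀ r, 0 < r → deriv (deriv φ) r = -(M / r * deriv φ r) - W r * φ r := by
  have hWc := hW.continuous
  have hbd : ∀ R : ℝ, ∃ K, 0 ≤ K ∧ ∀ r, |r| ≤ R → |W r| ≤ K := fun R => by
    obtain ⟨K, hK⟩ := (isCompact_closedBall (0 : ℝ) R).exists_bound_of_continuousOn
      hWc.continuousOn
    exact ⟨|K|, abs_nonneg K, fun r hr => (hK r (by simpa using hr)).trans (le_abs_self K)⟩
  choose K hK0 hK using hbd
  set b : ℝ → ℕ → ℝ := fun R i => (K R / 2 * R ^ 2) ^ i / i.factorial with hbdef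
  have hbs : ∀ R, Summable (b R) := fun R => Real.summable_pow_div_factorial _
  have hle : ∀ R i r, |r| ≤ R → |picardTerm M W i r| ≤ b R i := fun R i r hr => by
    refine (abs_picardTerm_le M (hK0 R) (hK R) i r hr).trans ?_
    rw [hbdef]
    simp only
    rw [mul_pow, pow_mul, div_mul_eq_mul_div]
    have := hK0 R
    gcongr
  have hterm := continuous_picardTerm M hWc
  set φ : ℝ → ℝ := fun r => ∑' i, picardTerm M W i r with hφ
  have hφc : Continuous φ := (continuous_tsum_and_hasSum_segMean 0 hterm hbs hle).1
  have hWφ : (fun r => ∑' i, W r * picardTerm M W i r) = fun r => W r * φ r :=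
    funext fun r => tsum_mul_left
  have hle' : ∀ R i r, |r| ≤ R → |W r * picardTerm M W i r| ≤ K R * b R i := fun R i r hr => by
    rw [abs_mul]
    exact mul_le_mul (hK R r hr) (hle R i r hr) (abs_nonneg _) (hK0 R)
  have hs1 := (continuous_tsum_and_hasSum_segMean M
    (g := fun i r => W r * picardTerm M W i r) (fun i => hWc.mul (hterm i))
    (fun R => (hbs R).mul_left (K R)) hle').2
  rw [hWφ] at hs1
  have hs2 := (continuous_tsum_and_hasSum_segMean 1
    (g := fun i => segMean M fun ρ => W ρ * picardTerm M W i ρ)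
    (fun i => continuous_segMean M (hWc.mul (hterm i)))
    (fun R => (hbs R).mul_left (K R)) fun R i r hr => by
      refine (abs_segMean_le M 0 (B := K R * b R i) fun ρ hρ => ?_).trans ?_
      · rw [pow_zero, mul_one]
        exact hle' R i ρ (hρ.trans hr)
      · have h0 : 0 ≤ K R * b R i := (abs_nonneg _).trans (hle' R i r hr)
        rw [pow_zero, mul_one]
        refine div_le_self h0 ?_
        have : (0 : ℝ) ≤ M := M.cast_nonneg
        push_cast
        linarith).2
  rw [show (fun r => ∑' i, segMean M (fun ρ => W ρ * picardTerm M W i ρ) r) =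
    segMean M (fun r => W r * φ r) from funext fun r => (hs1 r).tsum_eq] at hs2
  have hWφc : Continuous fun r => W r * φ r := hWc.mul hφc
  have hint : φ = fun r => 1 - r ^ (1 + 1) * segMean 1 (segMean M fun ρ => W ρ * φ ρ) r := by
    funext r
    have h1 : Summable fun i => picardTerm M W i r :=
      Summable.of_norm_bounded (hbs |r|) fun i => hle _ i r le_rfl
    rw [hφ]
    simp only
    rw [h1.tsum_eq_zero_add, sub_eq_add_neg]
    congr 1
    exact ((hs2 r).mul_left (r ^ 2)).neg.tsum_eq
  have hd : ∀ r, HasDerivAt φ (-(r * segMean M (fun ρ => W ρ * φ ρ) r)) r := fun r => by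
    have h1 := (hasDerivAt_pow_succ_mul_segMean 1 (continuous_segMean M hWφc) r).const_sub 1
    rw [← hint, pow_one] at h1
    exact h1
  have hderiv : deriv φ = fun r => -(r * segMean M (fun ρ => W ρ * φ ρ) r) :=
    funext fun r => (hd r).deriv
  -- The right-hand side of the integral equation gains one derivative.
  have hsm : ∀ k : ℕ, ContDiff ℝ k φ := fun k => by
    induction k with
    | zero => exact contDiff_zero.2 hφc
    | succ k ih =>
      rw [Nat.cast_succ, contDiff_succ_iff_deriv]
      refine ⟨fun r => (hd r).differentiableAt, by simp, ?_⟩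
      rw [hderiv]
      exact (contDiff_id.mul (contDiff_nat_segMean k M ((contDiff_infty.1 hW k).mul ih))).neg
  refine ⟨φ, contDiff_infty.2 hsm, fun r => ?_, ?_, fun r hr => ?_⟩
  · exact tsum_congr fun i => even_picardTerm M hWe i r
  · rw [hint]; simp
  · have h1 := hasDerivAt_pow_succ_mul_segMean M hWφc r
    -- Differentiate `r ^ M φ' = -r ^ (M + 1) segMean M (W φ)` in both ways.
    have h2 : (fun r => r ^ (M + 1) * segMean M (fun ρ => W ρ * φ ρ) r) =
        fun r => -(r ^ M * deriv φ r) := by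
      funext ρ
      rw [hderiv, pow_succ]
      ring
    rw [h2] at h1
    have h3 := ((hasDerivAt_pow M r).fun_mul
      (hasDerivAt_of_contDiff (contDiff_deriv (contDiff_infty.2 hsm)) r)).fun_neg
    have h4 := h1.unique h3
    have h5 : (M : ℝ) * r ^ (M - 1) = M / r * r ^ M := by
      rcases M with _ | M
      · simp
      · rw [Nat.add_sub_cancel, pow_succ]
        field_simp
    rw [h5] at h4
    have h6 : r ^ M ≠ 0 := pow_ne_zero _ hr.ne'
    have h7 : r ^ M * deriv (deriv φ) r = r ^ M * (-(M / r * deriv φ r) - W r * φ r) := by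
      linarith
    exact mul_left_cancel₀ h6 h7

section RegularFactor

variable {d p : ℕ} {Q : Eucl d → ℝ}

theorem IsGroundState.exists_isRegularFactor (hd : 0 < d) (hQ : IsGroundState d p Q) (n : ℕ) :
    ∃ φ, IsRegularFactor d p Q n φ := by
  have hq := contDiff_radialProfile hd hQ.smooth
  obtain ⟨φ, h1, h2, h3, h4⟩ := exists_regular_solution (d + 2 * n - 1)
    (W := fun r => p * radialProfile Q r ^ (p - 1)) (contDiff_const.mul (hq.pow _))
    fun r => by simp only [hQ.even_profile hd r]
  refine ⟨φ, h1, h2, h3 ▸ one_pos, fun r hr => ?_⟩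
  rw [h4 r hr, Nat.cast_sub (by omega)]
  push_cast
  ring

/-- For `n = 0` the regular solution is generated by the scaling invariance. -/
theorem IsGroundState.isRegularFactor_scaling (hd : 11 ≤ d) (hp : pJL d < p)
    (hQ : IsGroundState d p Q) {C : ℝ} (hC : 0 < C) :
    IsRegularFactor d p Q 0 fun r => 1 / C * (2 / ((p : ℝ) - 1) * radialProfile Q r +
      r * deriv (radialProfile Q) r) := by
  have hd0 : 0 < d := by omega
  have hq := contDiff_radialProfile hd0 hQ.smooth
  have hq' := contDiff_deriv hq
  refine ⟨by fun_prop, fun r => ?_, ?_, fun r hr => ?_⟩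
  · simp only [hQ.even_profile hd0 r, even_deriv_neg (hQ.even_profile hd0) r]
    ring
  · have := one_lt_of_pJL_lt hd hp
    have : 0 < (p : ℝ) - 1 := by linarith
    simp only [hQ.profile_zero hd0, mul_one, zero_mul, add_zero]
    positivity
  · set q := radialProfile Q with hqdef
    set m := 2 / ((p : ℝ) - 1) with hm
    have h1 : deriv (fun r => 1 / C * (m * q r + r * deriv q r)) =
        fun r => 1 / C * (m * deriv q r + (deriv q r + r * deriv (deriv q) r)) :=
      funext fun r => ((hasDerivAt_euler hq m r).const_mul (1 / C)).deriv
    -- The equation gives `r q''` as a function which can be differentiated once more.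
    have h2 : (fun r => m * deriv q r + (deriv q r + r * deriv (deriv q) r)) =ᶠ[𝓝 r]
        fun r => (m + 2 - d) * deriv q r - r * q r ^ p := by
      filter_upwards [lt_mem_nhds hr] with x hx
      rw [hQ.deriv_deriv_profile hd0 hx]
      field_simp
      ring
    have h3 : HasDerivAt (fun r => (m + 2 - d) * deriv q r - r * q r ^ p)
        ((m + 2 - d) * deriv (deriv q) r -
          (1 * q r ^ p + r * (p * q r ^ (p - 1) * deriv q r))) r :=
      ((hasDerivAt_of_contDiff hq' r).const_mul _).sub
        ((hasDerivAt_id' r).mul ((hasDerivAt_of_contDiff hq r).pow p))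
    have h4 := ((h3.congr_of_eventuallyEq h2).const_mul (1 / C)).deriv
    rw [h1, h4, hQ.deriv_deriv_profile hd0 hr]
    have hsplit : q r ^ p = q r ^ (p - 1) * q r := by
      have := two_le_of_pJL_lt hd hp
      rw [← pow_succ, Nat.sub_add_cancel (by omega)]
    have hmp : m * p = m + 2 := scaling_mul hd hp
    have hmp' : (p : ℝ) * q r ^ (p - 1) * (m * q r) = (m + 2) * q r ^ p := by
      rw [hsplit, ← hmp]; ring
    have h5 := h2.eq_of_nhds
    simp only [← hqdef] at h5 ⊢
    rw [h5, mul_left_comm ((p : ℝ) * q r ^ (p - 1)), mul_add ((p : ℝ) * q r ^ (p - 1)), hmp']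
    field_simp
    push_cast
    ring

/-- For `n = 1` the regular solution is generated by the translation invariance. -/
theorem IsGroundState.isRegularFactor_translation (hd : 11 ≤ d) (hQ : IsGroundState d p Q)
    {C : ℝ} (hC : 0 < C) :
    IsRegularFactor d p Q 1 fun r => -(1 / C) * radialDeriv (radialProfile Q) r := by
  have hd0 : 0 < d := by omega
  have hq := contDiff_radialProfile hd0 hQ.smooth
  have hq' := contDiff_deriv hq
  have hD := contDiff_radialDeriv hq
  have hD' := contDiff_deriv hD
  refine ⟨by fun_prop, fun r => ?_, ?_, fun r hr => ?_⟩
  · simp only [even_radialDeriv (hQ.even_profile hd0) r]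
  · have : (0 : ℝ) < d := by exact_mod_cast hd0
    rw [hQ.radialDeriv_profile_zero hd0, neg_mul_neg]
    positivity
  · set q := radialProfile Q with hqdef
    set D := radialDeriv q with hDdef
    have h1 : deriv (fun r => -(1 / C) * D r) = fun r => -(1 / C) * deriv D r :=
      funext fun r => ((hasDerivAt_of_contDiff hD r).const_mul _).deriv
    have h2 : deriv (fun r => -(1 / C) * deriv D r) r = -(1 / C) * deriv (deriv D) r :=
      ((hasDerivAt_of_contDiff hD' r).const_mul _).deriv
    have h3 : deriv q = fun r => r * D r :=
      funext (deriv_eq_mul_radialDeriv hq (hQ.even_profile hd0))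
    have h4 : deriv (deriv q) = fun r => D r + r * deriv D r := by
      funext ρ
      rw [h3]
      exact (((hasDerivAt_id' ρ).mul (hasDerivAt_of_contDiff hD ρ)).congr_deriv (by ring)).deriv
    -- The profile equation reads `r D' = -d D - q ^ p` and is differentiated once.
    have h5 : (fun r => r * deriv D r) =ᶠ[𝓝 r] fun r => -(d : ℝ) * D r - q r ^ p := by
      filter_upwards [lt_mem_nhds hr] with x hx
      have := hQ.profile_equation hd0 hx.le
      rw [← hqdef, h4] at this
      linarith
    have h6 := (hasDerivAt_id' r).mul (hasDerivAt_of_contDiff hD' r)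
    have h7 : HasDerivAt (fun r => -(d : ℝ) * D r - q r ^ p)
        (-(d : ℝ) * deriv D r - p * q r ^ (p - 1) * deriv q r) r :=
      ((hasDerivAt_of_contDiff hD r).const_mul _).sub ((hasDerivAt_of_contDiff hq r).pow p)
    have h8 := h6.unique (h7.congr_of_eventuallyEq h5)
    rw [h3] at h8
    rw [h1, h2]
    have h9 : deriv (deriv D) r =
        -(((d : ℝ) + 2 * 1 - 1) / r * deriv D r) - p * q r ^ (p - 1) * D r := by
      field_simp
      linarith
    rw [h9]
    push_cast
    ring

end RegularFactor

/-! ### The kernel of the radial operator -/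

section Kernel

variable {d p n : ℕ} {Q : Eucl d → ℝ}

theorem hasDerivAt_of_contDiffOn_Ioi {f : ℝ → ℝ} (hf : ContDiffOn ℝ ∞ f (Ioi 0)) {r : ℝ}
    (hr : 0 < r) : HasDerivAt f (deriv f r) r :=
  ((hf.differentiableOn (by simp)).differentiableAt (Ioi_mem_nhds hr)).hasDerivAt

theorem contDiffOn_deriv_Ioi {f : ℝ → ℝ} (hf : ContDiffOn ℝ ∞ f (Ioi 0)) :
    ContDiffOn ℝ ∞ (deriv f) (Ioi 0) :=
  ((contDiffOn_infty_iff_deriv_of_isOpen isOpen_Ioi).1 hf).2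

theorem hasDerivAt_pow_div (n : ℕ) {r : ℝ} (hr : 0 < r) :
    HasDerivAt (fun r : ℝ => r ^ n) (n / r * r ^ n) r := by
  refine (hasDerivAt_pow n r).congr_deriv ?_
  rcases n with _ | n
  · simp
  · rw [Nat.add_sub_cancel, pow_succ]
    field_simp

/-- Multiplication by `r ^ n` turns solutions of the equation with the centrifugal term removed
into elements of the kernel. -/
theorem inKernel_pow_mul {χ : ℝ → ℝ} (hχ : ContDiffOn ℝ ∞ χ (Ioi 0))
    (heq : ∀ r, 0 < r → deriv (deriv χ) r =
      -(((d : ℝ) + 2 * n - 1) / r * deriv χ r) - p * radialProfile Q r ^ (p - 1) * χ r) :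
    InKernel d p Q n fun r => r ^ n * χ r := by
  refine ⟨(contDiff_id.pow n).contDiffOn.mul hχ, fun r hr => ?_⟩
  have h1 : ∀ r, 0 < r → HasDerivAt (fun r => r ^ n * χ r)
      (r ^ n * (n * r⁻¹ * χ r + deriv χ r)) r := fun r hr =>
    ((hasDerivAt_pow_div n hr).mul (hasDerivAt_of_contDiffOn_Ioi hχ hr)).congr_deriv (by
      field_simp)
  have h2 := (hasDerivAt_pow_div n hr).fun_mul
    ((((hasDerivAt_inv hr.ne').const_mul (n : ℝ)).fun_mul
      (hasDerivAt_of_contDiffOn_Ioi hχ hr)).fun_add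
      (hasDerivAt_of_contDiffOn_Ioi (contDiffOn_deriv_Ioi hχ) hr))
  have h3 : deriv (fun r => r ^ n * χ r) =ᶠ[𝓝 r]
      fun r => r ^ n * (n * r⁻¹ * χ r + deriv χ r) := by
    filter_upwards [lt_mem_nhds hr] with x hx
    exact (h1 x hx).deriv
  rw [radialH, (h2.congr_of_eventuallyEq h3).deriv, (h1 r hr).deriv, heq r hr]
  field_simp
  ring

theorem InKernel.deriv_deriv {f : ℝ → ℝ} (hf : InKernel d p Q n f) {r : ℝ} (hr : 0 < r) :
    deriv (deriv f) r = -(((d : ℝ) - 1) / r * deriv f r) +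
      (n * ((d : ℝ) + n - 2) / r ^ 2 - p * radialProfile Q r ^ (p - 1)) * f r := by
  have := hf.2 r hr
  rw [radialH] at this
  linarith

theorem const_of_hasDerivAt_zero {g : ℝ → ℝ} (hg : ∀ r, 0 < r → HasDerivAt g 0 r) {r : ℝ}
    (hr : 0 < r) : g r = g 1 :=
  isOpen_Ioi.is_const_of_deriv_eq_zero isPreconnected_Ioi
    (fun x hx => (hg x hx).differentiableAt.differentiableWithinAt)
    (fun x hx => (hg x hx).deriv) hr (mem_Ioi.2 one_pos)

/-- Reduction of order: since the Wronskian of two solutions is a multiple of `r ^ (1 - d)`, a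
solution without zeros determines all the others. -/
theorem InKernel.eq_mul_add (hd : 0 < d) {f T I : ℝ → ℝ} (hf : InKernel d p Q n f)
    (hT : InKernel d p Q n T) (hpos : ∀ r, 0 < r → 0 < T r)
    (hI : ∀ r, 0 < r → HasDerivAt I (r ^ (d - 1) * T r ^ 2)⁻¹ r) :
    ∃ a b : ℝ, ∀ r, 0 < r → f r = T r * (a + b * I r) := by
  have hd1 : ((d - 1 : ℕ) : ℝ) = d - 1 := by rw [Nat.cast_sub hd, Nat.cast_one]
  have hW : ∀ r, 0 < r → HasDerivAt
      (fun r => r ^ (d - 1) * (deriv f r * T r - f r * deriv T r)) 0 r := fun r hr => by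
    have hf1 := hasDerivAt_of_contDiffOn_Ioi hf.1 hr
    have hf2 := hasDerivAt_of_contDiffOn_Ioi (contDiffOn_deriv_Ioi hf.1) hr
    have hT1 := hasDerivAt_of_contDiffOn_Ioi hT.1 hr
    have hT2 := hasDerivAt_of_contDiffOn_Ioi (contDiffOn_deriv_Ioi hT.1) hr
    refine ((hasDerivAt_pow_div (d - 1) hr).mul
      ((hf2.mul hT1).sub (hf1.mul hT2))).congr_deriv ?_
    simp only [Pi.sub_apply, Pi.mul_apply]
    rw [hf.deriv_deriv hr, hT.deriv_deriv hr, hd1]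
    ring
  set b := (1 : ℝ) ^ (d - 1) * (deriv f 1 * T 1 - f 1 * deriv T 1) with hb
  have hconst : ∀ r, 0 < r → HasDerivAt (fun r => f r / T r - b * I r) 0 r := fun r hr => by
    have hf1 := hasDerivAt_of_contDiffOn_Ioi hf.1 hr
    have hT1 := hasDerivAt_of_contDiffOn_Ioi hT.1 hr
    refine ((hf1.div hT1 (hpos r hr).ne').sub ((hI r hr).const_mul b)).congr_deriv ?_
    rw [hb, ← const_of_hasDerivAt_zero hW hr]
    have h1 := (hpos r hr).ne'
    have h2 : r ^ (d - 1) ≠ 0 := pow_ne_zero _ hr.ne'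
    field_simp
    ring
  refine ⟨f 1 / T 1 - b * I 1, b, fun r hr => ?_⟩
  rw [← const_of_hasDerivAt_zero hconst hr]
  have h1 := (hpos r hr).ne'
  field_simp
  ring

/-- The growth at the origin of a function whose derivative is asymptotic to
`h₀ r ^ (-M - 1)`. -/
theorem tendsto_pow_mul_primitive {M : ℕ} (hM : 0 < M) {I h : ℝ → ℝ} {h₀ : ℝ}
    (hI : ∀ r, 0 < r → HasDerivAt I (h r / r ^ (M + 1)) r)
    (hh : Tendsto h (𝓝[>] 0) (𝓝 h₀)) :
    Tendsto (fun r => r ^ M * I r) (𝓝[>] 0) (𝓝 (-(h₀ / M))) := by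
  have hM' : (1 : ℝ) ≤ M := by exact_mod_cast hM
  refine Metric.tendsto_nhds.2 fun η hη => ?_
  set ε := η / 3 with hε
  have hε0 : 0 < ε := by positivity
  obtain ⟨r0, hr0, hsub⟩ := mem_nhdsGT_iff_exists_Ioc_subset.1
    (hh.eventually (Metric.ball_mem_nhds h₀ hε0))
  have hclose : ∀ r ∈ Ioc 0 r0, |h r - h₀| ≤ ε := fun r hr => by
    have : h r ∈ Metric.ball h₀ ε := hsub hr
    rw [Metric.mem_ball, Real.dist_eq] at this
    exact this.le
  have hinv : ∀ r, 0 < r → HasDerivAt (fun r : ℝ => ((M : ℝ) * r ^ M)⁻¹) (-(1 / r ^ (M + 1))) r :=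
    fun r hr => by
      have h1 : (M : ℝ) * r ^ M ≠ 0 := by positivity
      refine (((hasDerivAt_pow_div M hr).const_mul (M : ℝ)).inv h1).congr_deriv ?_
      rw [pow_succ]
      field_simp
      ring
  have hanti := antitoneOn_of_hasDerivAt_nonpos (convex_Ioc 0 r0)
    (fun r hr => (hI r hr.1).fun_add ((hinv r hr.1).const_mul (h₀ + ε))) fun r hr => by
      have h1 := (abs_le.1 (hclose r hr)).2
      have h2 : 0 < r ^ (M + 1) := pow_pos hr.1 _
      have h3 : h r / r ^ (M + 1) + (h₀ + ε) * -(1 / r ^ (M + 1)) =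
        (h r - h₀ - ε) / r ^ (M + 1) := by ring
      rw [h3]
      exact div_nonpos_of_nonpos_of_nonneg (by linarith) h2.le
  have hmono := monotoneOn_of_hasDerivAt_nonneg (convex_Ioc 0 r0)
    (fun r hr => (hI r hr.1).fun_add ((hinv r hr.1).const_mul (h₀ - ε))) fun r hr => by
      have h1 := (abs_le.1 (hclose r hr)).1
      have h2 : 0 < r ^ (M + 1) := pow_pos hr.1 _
      have h3 : h r / r ^ (M + 1) + (h₀ - ε) * -(1 / r ^ (M + 1)) =
        (h r - h₀ + ε) / r ^ (M + 1) := by ring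
      rw [h3]
      exact div_nonneg (by linarith) h2.le
  have hsmall : ∀ G : ℝ, ∀ᶠ r in 𝓝[>] (0 : ℝ), |r ^ M * G| < ε := fun G => by
    have h1 : Continuous fun r : ℝ => |r ^ M * G| := by fun_prop
    have h2 := (h1.tendsto 0).mono_left (nhdsWithin_le_nhds (s := Ioi 0))
    rw [zero_pow hM.ne', zero_mul, abs_zero] at h2
    exact h2.eventually (gt_mem_nhds hε0)
  filter_upwards [hsmall (I r0 + (h₀ + ε) * ((M : ℝ) * r0 ^ M)⁻¹),
    hsmall (I r0 + (h₀ - ε) * ((M : ℝ) * r0 ^ M)⁻¹), Ioc_mem_nhdsGT hr0] with r h1 h2 hr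
  have h3 := hanti hr (right_mem_Ioc.2 hr0) hr.2
  have h4 := hmono hr (right_mem_Ioc.2 hr0) hr.2
  simp only at h3 h4
  have hrM : 0 < r ^ M := pow_pos hr.1 M
  have h5 := mul_le_mul_of_nonneg_left h3 hrM.le
  have h6 := mul_le_mul_of_nonneg_left h4 hrM.le
  have e1 : ∀ x : ℝ, r ^ M * (I r + x * ((M : ℝ) * r ^ M)⁻¹) = r ^ M * I r + x / M := fun x => by
    field_simp
  rw [e1] at h5 h6
  have h7 : ε / M ≤ ε := div_le_self hε0.le hM'
  rw [add_div] at h5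
  rw [sub_div] at h6
  have h8 := (abs_lt.1 h1).1
  have h9 := (abs_lt.1 h2).2
  rw [Real.dist_eq, abs_lt]
  constructor <;> linarith

/-- With `N = d + 2 n - 1` the denominator is `r ^ (d - 1) T ²`, for `T = r ^ n φ`. -/
theorem exists_primitive {N : ℕ} {φ : ℝ → ℝ} (hφ : ContDiff ℝ ∞ φ)
    (hpos : ∀ r, 0 < r → 0 < φ r) :
    ∃ I : ℝ → ℝ, ContDiffOn ℝ ∞ I (Ioi 0) ∧
      ∀ r, 0 < r → HasDerivAt I (r ^ N * φ r ^ 2)⁻¹ r := by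
  have hk : ContDiffOn ℝ ∞ (fun r => (r ^ N * φ r ^ 2)⁻¹) (Ioi 0) :=
    ((contDiff_id.pow N).mul (hφ.pow 2)).contDiffOn.inv fun r hr =>
      (mul_pos (pow_pos hr N) (pow_pos (hpos r hr) 2)).ne'
  have hI : ∀ r, 0 < r → HasDerivAt (fun r => ∫ ρ in (1 : ℝ)..r, (ρ ^ N * φ ρ ^ 2)⁻¹)
      (r ^ N * φ r ^ 2)⁻¹ r := fun r hr => by
    refine intervalIntegral.integral_hasDerivAt_right ?_
      (hk.continuousOn.stronglyMeasurableAtFilter isOpen_Ioi r hr)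
      (hk.continuousOn.continuousAt (Ioi_mem_nhds hr))
    exact (hk.continuousOn.mono fun x hx =>
      (lt_min one_pos hr).trans_le hx.1).intervalIntegrable
  refine ⟨_, (contDiffOn_infty_iff_deriv_of_isOpen isOpen_Ioi).2 ⟨fun r hr =>
    (hI r hr).differentiableAt.differentiableWithinAt, hk.congr fun r hr => (hI r hr).deriv⟩, hI⟩

namespace IsRegularFactor

variable {φ I : ℝ → ℝ}

theorem inKernel (h : IsRegularFactor d p Q n φ) : InKernel d p Q n fun r => r ^ n * φ r :=
  inKernel_pow_mul h.smooth.contDiffOn h.equation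

theorem inKernel_second (hd : 0 < d) (h : IsRegularFactor d p Q n φ)
    (hpos : ∀ r, 0 < r → 0 < φ r) (hIs : ContDiffOn ℝ ∞ I (Ioi 0))
    (hI : ∀ r, 0 < r → HasDerivAt I (r ^ (d + 2 * n - 1) * φ r ^ 2)⁻¹ r) (K : ℝ) :
    InKernel d p Q n fun r => r ^ n * (φ r * (K - I r)) := by
  refine inKernel_pow_mul (h.smooth.contDiffOn.mul (contDiffOn_const.sub hIs)) fun r hr => ?_
  have hφ := hasDerivAt_of_contDiff h.smooth
  have hφ' := hasDerivAt_of_contDiff (contDiff_deriv h.smooth)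
  have h1 : ∀ r, 0 < r → HasDerivAt (fun r => φ r * (K - I r))
      (deriv φ r * (K - I r) + φ r * -(r ^ (d + 2 * n - 1) * φ r ^ 2)⁻¹) r := fun r hr =>
    (hφ r).mul ((hI r hr).const_sub K)
  have h2 : deriv (fun r => φ r * (K - I r)) =ᶠ[𝓝 r] fun r =>
      deriv φ r * (K - I r) + φ r * -(r ^ (d + 2 * n - 1) * φ r ^ 2)⁻¹ := by
    filter_upwards [lt_mem_nhds hr] with x hx
    exact (h1 x hx).deriv
  have hne : r ^ (d + 2 * n - 1) * φ r ^ 2 ≠ 0 :=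
    (mul_pos (pow_pos hr _) (pow_pos (hpos r hr) 2)).ne'
  have h3 := ((hφ' r).fun_mul ((hI r hr).const_sub K)).fun_add ((hφ r).fun_mul
    (((hasDerivAt_pow_div (d + 2 * n - 1) hr).fun_mul ((hφ r).fun_pow 2)).fun_inv hne).fun_neg)
  rw [(h3.congr_of_eventuallyEq h2).deriv, (h1 r hr).deriv, h.equation r hr,
    Nat.cast_sub (by omega)]
  have h4 : r ^ (d + 2 * n - 1) ≠ 0 := pow_ne_zero _ hr.ne'
  have h5 := (hpos r hr).ne'
  push_cast
  field_simp
  ring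

/-- The primitive converges at infinity, since the regular solution dominates `r ^ (-γ_n)` and
`2 γ_n < d - 2`. -/
theorem exists_primitive_limit (hd : 11 ≤ d) (hp : pJL d < p) (hQ : IsGroundState d p Q)
    (h : IsRegularFactor d p Q n φ)
    (hI : ∀ r, 0 < r → HasDerivAt I (r ^ (d + 2 * n - 1) * φ r ^ 2)⁻¹ r) :
    ∃ L, Tendsto I atTop (𝓝 L) := by
  have hg := h.isDampedGrowth hd hp hQ
  have hδ := hg.damping_pos
  set δ := √(discr d p n) with hδdef
  set ψ := logFactor d p n φ with hψ
  have hJ : ∀ s, HasDerivAt (fun s => I (Real.exp s)) (Real.exp (-(δ * s)) * (ψ s ^ 2)⁻¹) s :=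
    fun s => by
      refine ((hI _ (Real.exp_pos s)).comp s (Real.hasDerivAt_exp s)).congr_deriv ?_
      have hφne := (h.pos hd hp hQ (Real.exp_pos s)).ne'
      have hexp : Real.exp (δ * s) * Real.exp ((gammaExp d p n + n) * s) ^ 2 * Real.exp s =
          Real.exp s ^ (d + 2 * n - 1) := by
        rw [← Real.exp_nat_mul, ← Real.exp_nat_mul, ← Real.exp_add, ← Real.exp_add,
          Nat.cast_sub (by omega), hδdef, sqrt_discr]
        congr 1
        push_cast
        ring
      rw [← hexp, hψ, logFactor, Real.exp_neg]
      field_simp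
  have hmono := monotone_of_hasDerivAt_nonneg hJ fun s => by positivity
  have hψ0 := hg.pos 0
  have hanti := antitoneOn_of_hasDerivAt_nonpos (convex_Ici 0) (fun s _ =>
    (hJ s).fun_add ((hasDerivAt_exp_neg_mul δ s).const_mul ((ψ 0 ^ 2)⁻¹ / δ))) fun s hs => by
      have h1 : (ψ s ^ 2)⁻¹ ≤ (ψ 0 ^ 2)⁻¹ :=
        inv_anti₀ (by positivity) (pow_le_pow_left₀ hψ0.le (hg.monotone hs) 2)
      have h2 : (ψ 0 ^ 2)⁻¹ / δ * -(δ * Real.exp (-(δ * s))) =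
        -(Real.exp (-(δ * s)) * (ψ 0 ^ 2)⁻¹) := by field_simp
      rw [h2]
      have := mul_le_mul_of_nonneg_left h1 (Real.exp_pos (-(δ * s))).le
      linarith
  have hbdd : BddAbove (range fun s => I (Real.exp s)) := by
    refine ⟨I (Real.exp 0) + (ψ 0 ^ 2)⁻¹ / δ * Real.exp (-(δ * 0)), ?_⟩
    rintro _ ⟨s, rfl⟩
    have h1 := hmono (le_max_left s 0)
    have h2 := hanti self_mem_Ici (mem_Ici.2 (le_max_right s 0)) (le_max_right s 0)
    have h3 : 0 ≤ (ψ 0 ^ 2)⁻¹ / δ * Real.exp (-(δ * max s 0)) := by positivity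
    simp only at h1 h2 ⊢
    linarith
  refine ⟨_, ((tendsto_atTop_ciSup hmono hbdd).comp Real.tendsto_log_atTop).congr' ?_⟩
  filter_upwards [eventually_gt_atTop 0] with r hr
  simp only [Function.comp_apply, Real.exp_log hr]

/-- The second solution, which is singular at the origin. A multiple of the regular solution is
added to the decaying solution `T ∫_r^∞ ρ ^ (1 - d) T (ρ) ^ (-2) dρ` so that it has the decay
`r ^ (-γ_n)` at infinity. -/
theorem exists_second (hd : 11 ≤ d) (hp : pJL d < p) (hQ : IsGroundState d p Q)
    (h : IsRegularFactor d p Q n φ) :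
    ∃ Γ : ℝ → ℝ, InKernel d p Q n Γ ∧
      (∀ f : ℝ → ℝ, InKernel d p Q n f →
        ∃ a b : ℝ, ∀ r : ℝ, 0 < r → f r = a * (r ^ n * φ r) + b * Γ r) ∧
      (∃ c' : ℝ, c' ≠ 0 ∧ Γ ~[𝓝[>] 0] fun r : ℝ => c' * r ^ (-((d : ℝ) - 2 + n))) ∧
      Γ ~[atTop] fun r => r ^ n * φ r := by
  have hpos : ∀ r, 0 < r → 0 < φ r := fun r hr => h.pos hd hp hQ hr
  obtain ⟨I, hIs, hI⟩ := exists_primitive (N := d + 2 * n - 1) h.smooth hpos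
  obtain ⟨L, hL⟩ := h.exists_primitive_limit hd hp hQ hI
  refine ⟨fun r => r ^ n * (φ r * (L + 1 - I r)),
    h.inKernel_second (by omega) hpos hIs hI (L + 1), fun f hf => ?_, ?_, ?_⟩
  · obtain ⟨a, b, hab⟩ := hf.eq_mul_add (by omega) h.inKernel
      (fun r hr => mul_pos (pow_pos hr n) (hpos r hr)) (I := I) (fun r hr => by
        refine (hI r hr).congr_deriv ?_
        rw [show d + 2 * n - 1 = d - 1 + n * 2 by omega, pow_add, pow_mul]
        ring)
    refine ⟨a + b * (L + 1), -b, fun r hr => ?_⟩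
    rw [hab r hr]
    ring
  · set M := d - 2 + 2 * n with hM
    have hM0 : 0 < M := by omega
    have hφ0 := h.zero_pos
    have hφt : Tendsto φ (𝓝[>] 0) (𝓝 (φ 0)) :=
      (h.smooth.continuous.tendsto 0).mono_left nhdsWithin_le_nhds
    have h1 := tendsto_pow_mul_primitive hM0 (I := I) (h := fun r => (φ r ^ 2)⁻¹)
      (fun r hr => (hI r hr).congr_deriv (by
        rw [show d + 2 * n - 1 = M + 1 by omega, mul_inv]; field_simp))
      ((hφt.pow 2).inv₀ (by positivity))
    have h2 : Tendsto (fun r : ℝ => r ^ M * (L + 1)) (𝓝[>] 0) (𝓝 0) := by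
      have hc : Continuous fun r : ℝ => r ^ M * (L + 1) := by fun_prop
      have := (hc.tendsto 0).mono_left (nhdsWithin_le_nhds (s := Ioi 0))
      rwa [zero_pow hM0.ne', zero_mul] at this
    have h3 := hφt.mul (h2.sub h1)
    have hMr : (0 : ℝ) < M := by exact_mod_cast hM0
    refine ⟨(φ 0 * M)⁻¹, by positivity, isEquivalent_of_tendsto_one ?_⟩
    have h4 := h3.const_mul (φ 0 * M)
    rw [show φ 0 * M * (φ 0 * (0 - -((φ 0 ^ 2)⁻¹ / M))) = 1 by field_simp; ring] at h4
    refine h4.congr' ?_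
    filter_upwards [self_mem_nhdsWithin] with r hr
    have hr' : 0 < r := hr
    have h5 : r ^ (-((d : ℝ) - 2 + n)) = (r ^ (d - 2 + n))⁻¹ := by
      rw [Real.rpow_neg hr'.le, ← Real.rpow_natCast]
      push_cast [Nat.cast_sub (show 2 ≤ d by omega)]
      rfl
    simp only [Pi.div_apply]
    rw [h5, hM, show d - 2 + 2 * n = n + (d - 2 + n) by omega, pow_add]
    field_simp
  · have h1 : Tendsto (fun r => L + 1 - I r) atTop (𝓝 1) := by
      simpa using hL.const_sub (L + 1)
    have h2 := (IsEquivalent.refl (u := fun r => r ^ n * φ r) (l := atTop)).mul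
      ((isEquivalent_const_iff_tendsto one_ne_zero).2 h1)
    refine (h2.congr_left (Eventually.of_forall fun r => ?_)).congr_right
      (Eventually.of_forall fun r => ?_)
    · simp only [Pi.mul_apply]; ring
    · simp

theorem exists_expansion (h : IsRegularFactor d p Q n φ) :
    ∃ c : ℕ → ℝ, c 0 ≠ 0 ∧ ∀ l : ℕ,
      (fun r : ℝ => r ^ n * φ r - ∑ j ∈ Finset.range (l + 1), c j * r ^ (n + 2 * j))
        =O[𝓝[>] 0] fun r : ℝ => r ^ (n + 2 + 2 * l) := by
  obtain ⟨c, hc0, hc⟩ := exists_even_expansion h.smooth h.even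
  refine ⟨c, hc0 ▸ h.zero_pos.ne', fun l => ?_⟩
  obtain ⟨g, hg, hexp⟩ := hc l
  have h1 : g =O[𝓝[>] 0] fun _ => (1 : ℝ) :=
    ((hg.tendsto 0).mono_left nhdsWithin_le_nhds).isBigO_one ℝ
  refine ((isBigO_refl (fun r : ℝ => r ^ (n + 2 + 2 * l)) _).mul h1).congr (fun r => ?_)
    fun r => mul_one _
  rw [hexp r, mul_add, Finset.mul_sum]
  have : ∑ j ∈ Finset.range (l + 1), r ^ n * (c j * r ^ (2 * j)) =
      ∑ j ∈ Finset.range (l + 1), c j * r ^ (n + 2 * j) :=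
    Finset.sum_congr rfl fun j _ => by rw [pow_add]; ring
  rw [this]
  ring

end IsRegularFactor

theorem eval_smul_of_isHomogeneous {σ : Type*} [Fintype σ] {P : MvPolynomial σ ℝ}
    (hP : P.IsHomogeneous n) (r : ℝ) (x : σ → ℝ) :
    MvPolynomial.eval (fun i => r * x i) P = r ^ n * MvPolynomial.eval x P := by
  rw [MvPolynomial.eval_eq', MvPolynomial.eval_eq', Finset.mul_sum]
  refine Finset.sum_congr rfl fun m hm => ?_
  have h1 : ∑ i, m i = n := by
    have := hP (MvPolynomial.mem_support_iff.1 hm)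
    rw [← this, Finsupp.weight_apply, Finsupp.sum_fintype _ _ (by simp)]
    simp
  simp only [mul_pow, Finset.prod_mul_distrib, Finset.prod_pow_eq_pow_sum, h1]
  ring

/-- The product of `r ^ n φ (r)` with a spherical harmonic is `φ (|y|)` times a homogeneous
polynomial, and both factors are smooth. -/
theorem IsRegularFactor.exists_smooth_extension {φ : ℝ → ℝ} (h : IsRegularFactor d p Q n φ)
    {Y : Metric.sphere (0 : Eucl d) 1 → ℝ} (hY : IsSphericalHarmonic n Y) :
    ∃ F : Eucl d → ℝ, ContDiff ℝ ∞ F ∧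
      ∀ (r : ℝ) (θ : Metric.sphere (0 : Eucl d) 1), 0 < r →
        F (r • (θ : Eucl d)) = r ^ n * φ r * Y θ := by
  obtain ⟨P, ⟨hP, -⟩, hYP⟩ := hY
  refine ⟨fun y => φ ‖y‖ * MvPolynomial.eval (fun i => y i) P,
    (contDiff_even_norm h.smooth h.even).mul ?_, fun r θ hr => ?_⟩
  · have h1 : ContDiff ℝ ∞ fun x : Fin d → ℝ => MvPolynomial.eval x P :=
      (AnalyticOnNhd.eval_mvPolynomial (𝕜 := ℝ) P).contDiff
    exact h1.comp (contDiff_pi.2 fun i => by fun_prop)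
  · have h1 : ‖r • (θ : Eucl d)‖ = r := by
      rw [norm_smul, norm_eq_of_mem_sphere, mul_one, Real.norm_of_nonneg hr.le]
    simp only [h1, hYP, PiLp.smul_apply, smul_eq_mul]
    rw [eval_smul_of_isHomogeneous hP]
    ring

end Kernel

end HeatKernelH

theorem mainTheorem4 (d p : ℕ) (hd : 11 ≤ d) (hp : Odd p) (hpJL : HeatKernelH.pJL d < p)
    (Q : HeatKernelH.Eucl d → ℝ) (hQ : HeatKernelH.IsGroundState d p Q)
    (C₀ C₁ : ℝ) (hC₀ : 0 < C₀) (hC₁ : 0 < C₁)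
    (hY₀ : ∫ _θ, C₀ ^ 2 ∂HeatKernelH.sphereMeasure d = 1)
    (hY₁ : ∀ k : Fin d,
      ∫ θ, (-C₁ * (θ : HeatKernelH.Eucl d) k) ^ 2 ∂HeatKernelH.sphereMeasure d = 1)
    (n : ℕ) :
    ∃ T Γ : ℝ → ℝ,
      -- two smooth solutions on `(0, ∞)` that span the kernel
      HeatKernelH.InKernel d p Q n T ∧ HeatKernelH.InKernel d p Q n Γ ∧
      (∀ f : ℝ → ℝ, HeatKernelH.InKernel d p Q n f →
        ∃ a b : ℝ, ∀ r : ℝ, 0 < r → f r = a * T r + b * Γ r) ∧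
      -- expansion of `T` at the origin
      (∃ c : ℕ → ℝ, c 0 ≠ 0 ∧ ∀ l : ℕ,
        (fun r : ℝ => T r - ∑ j ∈ Finset.range (l + 1), c j * r ^ (n + 2 * j))
          =O[𝓝[>] 0] fun r : ℝ => r ^ (n + 2 + 2 * l)) ∧
      -- asymptotics of `T` at infinity
      (∃ C : ℝ, C ≠ 0 ∧
        (T ~[atTop] fun r : ℝ => C * r ^ (-HeatKernelH.gammaExp d p n)) ∧
        ∀ ε : ℝ, 0 < ε →
          (fun r : ℝ => T r - C * r ^ (-HeatKernelH.gammaExp d p n))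
            =O[atTop] fun r : ℝ =>
              r ^ (-HeatKernelH.gammaExp d p n - HeatKernelH.gExp d p ε)) ∧
      -- asymptotics of `Γ` at the origin and at infinity
      (∃ c' : ℝ, c' ≠ 0 ∧
        Γ ~[𝓝[>] 0] fun r : ℝ => c' * r ^ (-((d : ℝ) - 2 + n))) ∧
      (∃ c'' : ℝ, c'' ≠ 0 ∧
        Γ ~[atTop] fun r : ℝ => c'' * r ^ (-HeatKernelH.gammaExp d p n)) ∧
      -- positivity of `T`
      (∀ r : ℝ, 0 < r → 0 < T r) ∧
      -- `y ↦ T(|y|) Y(y / |y|)` is smooth on `ℝᵈ` for every spherical harmonic `Y` of degree `n`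
      (∀ Y : Metric.sphere (0 : HeatKernelH.Eucl d) 1 → ℝ,
        HeatKernelH.IsSphericalHarmonic n Y →
        ∃ F : HeatKernelH.Eucl d → ℝ, ContDiff ℝ ∞ F ∧
          ∀ (r : ℝ) (θ : Metric.sphere (0 : HeatKernelH.Eucl d) 1), 0 < r →
            F (r • (θ : HeatKernelH.Eucl d)) = T r * Y θ) ∧
      -- explicit formulas for `n = 0` and `n = 1`
      (n = 0 → ∀ r : ℝ, 0 < r →
        T r = 1 / C₀ * HeatKernelH.radialProfile (HeatKernelH.scalingGenerator p Q) r) ∧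
      (n = 1 → ∀ r : ℝ, 0 < r →
        T r = -(1 / C₁) * deriv (HeatKernelH.radialProfile Q) r) := by
  obtain ⟨φ, hφ, h0, h1⟩ : ∃ φ, HeatKernelH.IsRegularFactor d p Q n φ ∧
      (n = 0 → ∀ r : ℝ, 0 < r →
        r ^ n * φ r = 1 / C₀ * HeatKernelH.radialProfile (HeatKernelH.scalingGenerator p Q) r) ∧
      (n = 1 → ∀ r : ℝ, 0 < r →
        r ^ n * φ r = -(1 / C₁) * deriv (HeatKernelH.radialProfile Q) r) := by
    have hd0 : 0 < d := by omega
    rcases n with _ | _ | n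
    · refine ⟨_, hQ.isRegularFactor_scaling hd hpJL hC₀, fun _ r _ => ?_, by simp⟩
      rw [hQ.profile_scalingGenerator hd0, pow_zero, one_mul]
    · refine ⟨_, hQ.isRegularFactor_translation hd hC₁, by simp, fun _ r _ => ?_⟩
      rw [HeatKernelH.deriv_eq_mul_radialDeriv
        (HeatKernelH.contDiff_radialProfile hd0 hQ.smooth) (hQ.even_profile hd0)]
      ring
    · obtain ⟨φ, hφ⟩ := hQ.exists_isRegularFactor hd0 (n + 1 + 1)
      exact ⟨φ, hφ, by simp, by simp⟩
  obtain ⟨C, hC, hequiv, hrate⟩ := hφ.exists_asymptotics hd hpJL hQ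
  obtain ⟨Γ, hΓ, hspan, hΓ0, hΓT⟩ := hφ.exists_second hd hpJL hQ
  exact ⟨fun r => r ^ n * φ r, Γ, hφ.inKernel, hΓ, hspan, hφ.exists_expansion,
    ⟨C, hC.ne', hequiv, hrate⟩, hΓ0, ⟨C, hC.ne', hΓT.trans hequiv⟩,
    fun r hr => mul_pos (pow_pos hr n) (hφ.pos hd hpJL hQ hr),
    fun _ hY => hφ.exists_smooth_extension hY, h0, h1⟩
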